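/- **Theorem (eigenfunction estimates).** For $\kappa\ge 1$ let $\mathcal P_1(\kappa)$ be the class of functions $V:\mathbb R\to[0,\infty)$ such that $V(0)=0$, $V(-x)\le\kappa V(x)$ for all $x\in\mathbb R$, and $V$ is positive and $C^1$ on $\mathbb R\setminus\{0\}$ with $\kappa^{-1}V(x)\le xV'(x)\le\kappa V(x)$ for all $x\neq 0$. For $V\in\mathcal P_1(\kappa)$ the operator $-\partial_x^2+V$ is essentially self-adjoint on $C_c^\infty(\mathbb R)\subset L^2(\mathbb R)$, and its self-adjoint extension $\mathcal H[V]$ has pure point spectrum consisting of a divergent increasing sequence of simple eigenvalues $E_1<E_2<\cdots$, $E_n=E_n(V)>0$. Let $\psi_n=\psi_n(\cdot;V)\in C^2(\mathbb R)$ be the real-valued eigenfunction with $-\psi_n''+V\psi_n=E_n\psi_n$ on $\mathbb R$, $\int_{\mathbb R}\psi_n^2=1$, and $\psi_n(x)>0$ for all large enough $x>0$. Let $|A|$ denote the Lebesgue measure of $A\subseteq\mathbb R$. Let $\kappa\ge1$. (i) There are constants $K,c>0$, depending only on $\kappa$, such that for all $V\in\mathcal P_1(\kappa)$, all $n\ge1$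 and all $x\in\mathbb R$ with $V(x)\ge 4E_n$, $$\psi_n(x)^2+\frac{\psi_n'(x)^2}{E_n}\le \frac{K}{|\{V\le E_n\}|}\,e^{-c|x|\sqrt{V(x)}}.$$ (ii) For all $a,b\in\mathbb R$ there is a constant $K>0$, depending only on $a,b,\kappa$, such that the following holds for all $V\in\mathcal P_1(\kappa)$. If $W:\mathbb R\to[0,\infty)$ is measurable and $C>0$ is such that $$W(x)\le C|x|^aV(x)^b\quad\text{and}\quad\int_{-|x|}^{|x|}W(t)\,dt\le C|x|^{a+1}V(x)^b\qquad\text{for all }x\in\mathbb R\setminus\{0\},\tag{$*$}$$ then, for all $n\ge1$, $$\int_{\mathbb R}W(x)\Big(\psi_n(x)^2+\frac{\psi_n'(x)^2}{E_n}\Big)\,dx\le K\,C\,|\{V\le E_n\}|^a\,E_n^b.$$ (iii) For all $a,b\in\mathbb R$ with $a+\min\{\kappa^{-1}b,\kappa b\}>-1$ (that is, $a+\kappa^{-1}b>-1$ when $b\ge0$, and $a+\kappa b>-1$ when $b<0$) there is a constant $C>0$, depending only on $a,b,\kappa$, such that for every $V\in\mathcal P_1(\kappa)$ the weight $W(x)=|x|^aV(x)^b$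 satisfies $(*)$ with this $C$. -/

import Mathlib

open MeasureTheory Filter Topology

/-- The class `HP₁(κ)`: positive `C¹` functions on the open half-line `(0, ∞)` with
`κ⁻¹ V(x) ≤ x V'(x) ≤ κ V(x)`. Only the values of `V` on `(0, ∞)` matter. -/
structure IsHalfLineRegular (κ : ℝ) (V : ℝ → ℝ) : Prop where
  contDiffOn : ContDiffOn ℝ 1 V (Set.Ioi 0)
  pos : ∀ x : ℝ, 0 < x → 0 < V x
  lower : ∀ x : ℝ, 0 < x → κ⁻¹ * V x ≤ x * deriv V x
  upper : ∀ x : ℝ, 0 < x → x * deriv V x ≤ κ * V x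

/-- The class `P₁(κ)` of potentials on the real line. -/
structure IsRegularPotential (κ : ℝ) (V : ℝ → ℝ) : Prop where
  nonneg : ∀ x : ℝ, 0 ≤ V x
  zero : V 0 = 0
  comparable : ∀ x : ℝ, V (-x) ≤ κ * V x
  right : IsHalfLineRegular κ V
  left : IsHalfLineRegular κ (fun x => V (-x))

/-- The graph in `L²(ℝ) × L²(ℝ)` of the operator `-∂ₓ² + V` with domain `C_c^∞(ℝ)`. -/
def schrodingerTestGraph (V : ℝ → ℝ) :
    Set (Lp ℂ 2 (volume : Measure ℝ) × Lp ℂ 2 (volume : Measure ℝ)) :=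
  {p | ∃ φ : ℝ → ℂ, ContDiff ℝ (⊤ : ℕ∞) φ ∧ HasCompactSupport φ ∧
    p.1 =ᵐ[volume] φ ∧
    p.2 =ᵐ[volume] fun x => -iteratedDeriv 2 φ x + (V x : ℂ) * φ x}

/-- The graph of the Schrödinger operator `H[V]` on `L²(ℝ)`: the closure of the graph of
`-∂ₓ² + V` on `C_c^∞(ℝ)`. For continuous `V ≥ 0` the latter operator is essentially self-adjoint,
so that its closure is its unique self-adjoint extension. -/
def schrodingerGraph (V : ℝ → ℝ) :
    Set (Lp ℂ 2 (volume : Measure ℝ) × Lp ℂ 2 (volume : Measure ℝ)) :=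
  closure (schrodingerTestGraph V)

/-- The set of eigenvalues of `H[V]`. -/
def schrodingerEigenvalues (V : ℝ → ℝ) : Set ℝ :=
  {E | ∃ f : Lp ℂ 2 (volume : Measure ℝ), f ≠ 0 ∧ (f, (E : ℂ) • f) ∈ schrodingerGraph V}

/-- `E = E_n(V)`: the `n`-th eigenvalue of `H[V]`, where the (simple) eigenvalues are listed
increasingly and the numbering starts from `n = 1`. -/
def IsNthEigenvalue (V : ℝ → ℝ) (n : ℕ) (E : ℝ) : Prop :=
  E ∈ schrodingerEigenvalues V ∧
    {E' : ℝ | E' ∈ schrodingerEigenvalues V ∧ E' < E}.encard + 1 = (n : ℕ∞)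

/-- `ψ` is the real eigenfunction of `H[V]` of eigenvalue `E`, normalised to have `L²` norm `1`
and to be positive near `+∞`. -/
structure IsNormalizedEigenfunction (V : ℝ → ℝ) (E : ℝ) (ψ : ℝ → ℝ) : Prop where
  contDiff : ContDiff ℝ 2 ψ
  equation : ∀ x : ℝ, -deriv (deriv ψ) x + V x * ψ x = E * ψ x
  integrable_sq : Integrable (fun x => ψ x ^ 2)
  norm_eq_one : ∫ x, ψ x ^ 2 = 1
  eventually_pos : ∀ᶠ x in atTop, 0 < ψ x

/-- `|{V ≤ E}|`, the Lebesgue measure of the sublevel set. -/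
noncomputable def sublevelMeasure (V : ℝ → ℝ) (E : ℝ) : ℝ :=
  (volume : Measure ℝ).real {t | V t ≤ E}

/-- The two bounds on a weight `W ≥ 0`:
`W(x) ≤ C |x|^a V(x)^b` and `∫_{-|x|}^{|x|} W ≤ C |x|^{a+1} V(x)^b`, for all `x ≠ 0`.
The point `x = 0`, where real powers need not make sense, is left out. -/
structure IsDominatedWeight (V : ℝ → ℝ) (a b C : ℝ) (W : ℝ → ℝ) : Prop where
  pointwise : ∀ x : ℝ, x ≠ 0 → W x ≤ C * |x| ^ a * V x ^ b
  integral : ∀ x : ℝ, x ≠ 0 →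
    ∫⁻ t in Set.Icc (-|x|) |x|, ENNReal.ofReal (W t)
      ≤ ENNReal.ofReal (C * |x| ^ (a + 1) * V x ^ b)

/-! The class fixes only one length at energy `E`: the turning point `ρ > 0` with `V ρ = E`.
Integrating `κ⁻¹ V ≤ x V' ≤ κ V` shows that dilations and reflections change `V` by controlled
powers. With `M = (4κ)^κ`, one has `V ≤ E/4` for `|x| ≤ ρ/M` and `V ≥ 4E` for `|x| ≥ Mρ`, and `|{V ≤
E}|` lies between `ρ` and `2Mρ`.

The rest is ODE estimates for a normalised `L²` solution. The identity `(ψψ')' = ψ'² + (V - E)ψ²`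
gives `∫ ψ'² + Vψ² ≤ E`, hence `sup ψ² ≤ 2√E` and the uncertainty principle `ρ√E ≳ 1`
(`one_le_mul_sqrt`). In the bulk, `ψ'² + (E - V)ψ²` decreases away from `0` while its quotient by `E
- V` increases, so the mass is spread evenly and the density `g = ψ² + ψ'²/E` is `≲ 1/ρ`
(`sq_add_le_bulk`). In the forbidden region, convexity of `ψ²` gives exponential decay
(`sq_mul_exp_antitoneOn`, `exists_sq_add_le_tail`), which is (i). For (ii) the line is cut at `ρ/M`
and `Mρ`: the integral bound on `W` meets the bulk estimate inside, the pointwise bound on `W` meets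
`∫ g ≤ 2` in between, and decay beats polynomial growth outside. (iii) is scaling alone. -/

/-! ### Power-law scaling on the half-line. -/

namespace IsHalfLineRegular

variable {κ : ℝ} {V : ℝ → ℝ}

lemma hasDerivAt (h : IsHalfLineRegular κ V) {x : ℝ} (hx : 0 < x) :
    HasDerivAt V (deriv V x) x :=
  ((h.contDiffOn.differentiableOn one_ne_zero).differentiableAt (Ioi_mem_nhds hx)).hasDerivAt

lemma hasDerivAt_mul_rpow (h : IsHalfLineRegular κ V) (r : ℝ) {x : ℝ} (hx : 0 < x) :
    HasDerivAt (fun y => V y * y ^ (-r)) (x ^ (-r) / x * (x * deriv V x - r * V x)) x := by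
  have := (h.hasDerivAt hx).mul (Real.hasDerivAt_rpow_const (p := -r) (Or.inl hx.ne'))
  refine this.congr_deriv ?_
  rw [Real.rpow_sub_one hx.ne']
  field_simp
  ring

lemma antitoneOn_mul_rpow (h : IsHalfLineRegular κ V) :
    AntitoneOn (fun x => V x * x ^ (-κ)) (Set.Ioi 0) := by
  refine antitoneOn_of_deriv_nonpos (convex_Ioi 0)
    (fun x hx => (h.hasDerivAt_mul_rpow κ hx).continuousAt.continuousWithinAt) ?_ ?_ <;>
  rw [interior_Ioi]
  · exact fun x hx => (h.hasDerivAt_mul_rpow κ hx).differentiableAt.differentiableWithinAt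
  · intro x hx
    have hx' : 0 < x := hx
    rw [(h.hasDerivAt_mul_rpow κ hx).deriv]
    exact mul_nonpos_of_nonneg_of_nonpos (by positivity) (sub_nonpos.2 (h.upper x hx))

lemma monotoneOn_mul_rpow (h : IsHalfLineRegular κ V) :
    MonotoneOn (fun x => V x * x ^ (-κ⁻¹)) (Set.Ioi 0) := by
  refine monotoneOn_of_deriv_nonneg (convex_Ioi 0)
    (fun x hx => (h.hasDerivAt_mul_rpow κ⁻¹ hx).continuousAt.continuousWithinAt) ?_ ?_ <;>
  rw [interior_Ioi]
  · exact fun x hx => (h.hasDerivAt_mul_rpow κ⁻¹ hx).differentiableAt.differentiableWithinAt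
  · intro x hx
    have hx' : 0 < x := hx
    rw [(h.hasDerivAt_mul_rpow κ⁻¹ hx).deriv]
    exact mul_nonneg (by positivity) (sub_nonneg.2 (h.lower x hx))

lemma le_rpow_mul (h : IsHalfLineRegular κ V) {s t : ℝ} (hs : 0 < s) (hst : s ≤ t) :
    V t ≤ (t / s) ^ κ * V s := by
  have ht : 0 < t := hs.trans_le hst
  have := h.antitoneOn_mul_rpow hs ht hst
  simp only [Real.rpow_neg ht.le, Real.rpow_neg hs.le, ← div_eq_mul_inv] at this
  rw [div_le_iff₀ (by positivity)] at this
  rw [Real.div_rpow ht.le hs.le]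
  exact this.trans_eq (by ring)

lemma rpow_mul_le (h : IsHalfLineRegular κ V) {s t : ℝ} (hs : 0 < s) (hst : s ≤ t) :
    V s ≤ (s / t) ^ κ⁻¹ * V t := by
  have ht : 0 < t := hs.trans_le hst
  have := h.monotoneOn_mul_rpow hs ht hst
  simp only [Real.rpow_neg ht.le, Real.rpow_neg hs.le, ← div_eq_mul_inv] at this
  rw [div_le_iff₀ (by positivity)] at this
  rw [Real.div_rpow hs.le ht.le]
  exact this.trans_eq (by ring)

lemma deriv_nonneg (h : IsHalfLineRegular κ V) (hκ : 1 ≤ κ) {x : ℝ} (hx : 0 < x) :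
    0 ≤ deriv V x := by
  have h1 := h.lower x hx
  have h2 : 0 ≤ κ⁻¹ * V x := mul_nonneg (by positivity) (h.pos x hx).le
  exact nonneg_of_mul_nonneg_right (h2.trans h1) hx

lemma mono (h : IsHalfLineRegular κ V) (hκ : 1 ≤ κ) {s t : ℝ} (hs : 0 < s) (hst : s ≤ t) :
    V s ≤ V t := by
  have ht : 0 < t := hs.trans_le hst
  refine (h.rpow_mul_le hs hst).trans (mul_le_of_le_one_left (h.pos t ht).le ?_)
  exact Real.rpow_le_one (by positivity) ((div_le_one ht).2 hst) (by positivity)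

end IsHalfLineRegular

/-! ### Two-sided comparison, the turning point and the sublevel set. -/

namespace IsRegularPotential

variable {κ : ℝ} {V : ℝ → ℝ}

lemma reflect (h : IsRegularPotential κ V) : IsRegularPotential κ (fun x => V (-x)) where
  nonneg x := h.nonneg _
  zero := by simpa using h.zero
  comparable x := h.comparable (-x)
  right := h.left
  left := by simpa using h.right

/-- Scaling on the side of `x`, from `|t|` to `|x|`; the extra factor `κ` pays for a possible change
of sign. -/
lemma le_of_abs_le (h : IsRegularPotential κ V) (hκ : 1 ≤ κ) {t x : ℝ} (ht : t ≠ 0)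
    (htx : |t| ≤ |x|) : V x ≤ κ * (|x| / |t|) ^ κ * V t := by
  have key : ∀ {V : ℝ → ℝ}, IsRegularPotential κ V → ∀ {t x : ℝ}, t ≠ 0 → 0 < x → |t| ≤ x →
      V x ≤ κ * (x / |t|) ^ κ * V t := by
    intro V h t x ht hx htx
    have h1 := h.right.le_rpow_mul (abs_pos.2 ht) htx
    have h2 : V |t| ≤ κ * V t := by
      rcases abs_choice t with h' | h' <;> rw [h']
      · exact le_mul_of_one_le_left (h.nonneg t) hκ
      · exact h.comparable t
    have h3 : 0 ≤ (x / |t|) ^ κ := by positivity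
    nlinarith [mul_le_mul_of_nonneg_left h2 h3]
  have hx : x ≠ 0 := abs_pos.1 ((abs_pos.2 ht).trans_le htx)
  rcases hx.lt_or_gt with hx | hx
  · have := key h.reflect (t := -t) (x := -x) (neg_ne_zero.2 ht) (by linarith)
      (by rwa [abs_neg, ← abs_of_neg hx])
    simpa [abs_of_neg hx] using this
  · rw [abs_of_pos hx] at htx ⊢
    exact key h ht hx htx

lemma le_of_abs_le' (h : IsRegularPotential κ V) (hκ : 1 ≤ κ) {t x : ℝ} (ht : t ≠ 0)
    (htx : |t| ≤ |x|) : V t ≤ κ * (|t| / |x|) ^ κ⁻¹ * V x := by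
  have key : ∀ {V : ℝ → ℝ}, IsRegularPotential κ V → ∀ {t x : ℝ}, t ≠ 0 → 0 < x → |t| ≤ x →
      V t ≤ κ * (|t| / x) ^ κ⁻¹ * V x := by
    intro V h t x ht hx htx
    have h1 := h.right.rpow_mul_le (abs_pos.2 ht) htx
    have h2 : V t ≤ κ * V |t| := by
      rcases abs_choice t with h' | h' <;> rw [h']
      · exact le_mul_of_one_le_left (h.nonneg t) hκ
      · simpa using h.comparable (-t)
    have h3 : 0 ≤ κ := by linarith
    nlinarith [mul_le_mul_of_nonneg_left h1 h3]
  have hx : x ≠ 0 := abs_pos.1 ((abs_pos.2 ht).trans_le htx)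
  rcases hx.lt_or_gt with hx | hx
  · have := key h.reflect (t := -t) (x := -x) (neg_ne_zero.2 ht) (by linarith)
      (by rwa [abs_neg, ← abs_of_neg hx])
    simpa [abs_of_neg hx] using this
  · rw [abs_of_pos hx] at htx ⊢
    exact key h ht hx htx

lemma pos (h : IsRegularPotential κ V) {x : ℝ} (hx : x ≠ 0) : 0 < V x := by
  rcases hx.lt_or_gt with hx | hx
  · simpa using h.left.pos (-x) (by linarith)
  · exact h.right.pos x hx

lemma continuous (h : IsRegularPotential κ V) (hκ : 1 ≤ κ) : Continuous V := by
  rw [continuous_iff_continuousAt]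
  intro x
  rcases lt_trichotomy x 0 with hx | rfl | hx
  · have h1 : ContinuousAt (fun y => V (-y)) (-x) :=
      (h.left.hasDerivAt (by linarith)).continuousAt
    have := h1.comp (continuous_neg.continuousAt (x := x))
    simpa [Function.comp_def] using this
  · have hκ0 : 0 < κ := by linarith
    rw [ContinuousAt, h.zero]
    have hT : Tendsto (fun x : ℝ => κ * (|x| / |1|) ^ κ⁻¹ * V 1) (𝓝 0) (𝓝 0) := by
      have : Continuous (fun x : ℝ => κ * (|x| / |1|) ^ κ⁻¹ * V 1) := by
        have : Continuous (fun x : ℝ => (|x| / |1|) ^ κ⁻¹) :=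
          Continuous.rpow_const (by fun_prop) (fun x => Or.inr (by positivity))
        fun_prop
      have h0 := this.tendsto 0
      rwa [abs_zero, zero_div, Real.zero_rpow (by positivity), mul_zero, zero_mul] at h0
    refine tendsto_of_tendsto_of_tendsto_of_le_of_le' tendsto_const_nhds hT
      (Eventually.of_forall h.nonneg) ?_
    filter_upwards [Metric.ball_mem_nhds (0 : ℝ) one_pos] with y hy
    by_cases hy0 : y = 0
    · subst hy0
      rw [h.zero, abs_zero, zero_div, Real.zero_rpow (by positivity), mul_zero, zero_mul]
    · refine h.le_of_abs_le' hκ hy0 ?_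
      rw [abs_one]
      simpa using (mem_ball_zero_iff.1 hy).le
  · exact (h.right.hasDerivAt hx).continuousAt

lemma exists_eq (h : IsRegularPotential κ V) (hκ : 1 ≤ κ) {E : ℝ} (hE : 0 < E) :
    ∃ ρ : ℝ, 0 < ρ ∧ V ρ = E := by
  have hκ0 : 0 < κ := by linarith
  have hV1 := h.right.pos 1 one_pos
  -- Growth at least like `t ^ κ⁻¹` from the base point `1` reaches `E` by the time `t = (E / V 1) ^
  -- κ`.
  set t := max 1 ((E / V 1) ^ κ) with ht
  have ht1 : 1 ≤ t := le_max_left _ _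
  have htE : E ≤ V t := by
    have h1 := h.right.rpow_mul_le one_pos ht1
    have h2 : E / V 1 ≤ t ^ κ⁻¹ := by
      calc E / V 1 = ((E / V 1) ^ κ) ^ κ⁻¹ := by
            rw [Real.rpow_rpow_inv (by positivity) hκ0.ne']
        _ ≤ t ^ κ⁻¹ := Real.rpow_le_rpow (by positivity) (le_max_right _ _) (by positivity)
    rw [one_div, Real.inv_rpow (by linarith), inv_mul_eq_div, le_div_iff₀ (by positivity)] at h1
    rw [div_le_iff₀ hV1] at h2
    linarith
  obtain ⟨ρ, hρ, hρE⟩ := intermediate_value_Icc (by linarith : (0 : ℝ) ≤ t)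
    (h.continuous hκ).continuousOn (⟨by rw [h.zero]; exact hE.le, htE⟩ : E ∈ Set.Icc (V 0) (V t))
  refine ⟨ρ, lt_of_le_of_ne hρ.1 ?_, hρE⟩
  rintro rfl
  rw [h.zero] at hρE
  exact hE.ne hρE

/-- The dilation factor `M = (4κ)^κ` satisfies `κ * M ^ (-κ⁻¹) = 1/4`: moving by this factor changes
`V` at least fourfold, even across the origin. -/
lemma one_le_scale (hκ : 1 ≤ κ) : 1 ≤ (4 * κ) ^ κ :=
  Real.one_le_rpow (by linarith) (by linarith)

lemma four_mul_le (h : IsRegularPotential κ V) (hκ : 1 ≤ κ) {ρ x : ℝ} (hρ : 0 < ρ)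
    (hx : (4 * κ) ^ κ * ρ ≤ |x|) : 4 * V ρ ≤ V x := by
  have hM := one_le_scale hκ
  have hκ0 : 0 < κ := by linarith
  have hρx : |ρ| ≤ |x| := by rw [abs_of_pos hρ]; nlinarith
  have hx0 : 0 < |x| := (abs_pos.2 hρ.ne').trans_le hρx
  have h1 := h.le_of_abs_le' hκ hρ.ne' hρx
  have h2 : 4 * κ * (|ρ| / |x|) ^ κ⁻¹ ≤ 1 := by
    calc 4 * κ * (|ρ| / |x|) ^ κ⁻¹ = (((4 * κ) ^ κ) * (|ρ| / |x|)) ^ κ⁻¹ := by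
          rw [Real.mul_rpow (by positivity) (by positivity),
            Real.rpow_rpow_inv (by positivity) hκ0.ne']
      _ ≤ 1 := by
          refine Real.rpow_le_one (by positivity) ?_ (by positivity)
          rw [abs_of_pos hρ, ← mul_div_assoc, div_le_one hx0]
          exact hx
  nlinarith [h.nonneg x]

lemma four_mul_le' (h : IsRegularPotential κ V) (hκ : 1 ≤ κ) {ρ x : ℝ} (hρ : 0 < ρ)
    (hx : (4 * κ) ^ κ * |x| ≤ ρ) : 4 * V x ≤ V ρ := by
  by_cases hx0 : x = 0
  · rw [hx0, h.zero]
    simpa using h.nonneg ρ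
  have hM := one_le_scale hκ
  have hκ0 : 0 < κ := by linarith
  have hx0' : 0 < |x| := abs_pos.2 hx0
  have hρx : |x| ≤ |ρ| := by rw [abs_of_pos hρ]; nlinarith
  have h1 := h.le_of_abs_le' hκ hx0 hρx
  have h2 : 4 * κ * (|x| / |ρ|) ^ κ⁻¹ ≤ 1 := by
    calc 4 * κ * (|x| / |ρ|) ^ κ⁻¹ = (((4 * κ) ^ κ) * (|x| / |ρ|)) ^ κ⁻¹ := by
          rw [Real.mul_rpow (by positivity) (by positivity),
            Real.rpow_rpow_inv (by positivity) hκ0.ne']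
      _ ≤ 1 := by
          refine Real.rpow_le_one (by positivity) ?_ (by positivity)
          rw [abs_of_pos hρ, ← mul_div_assoc, div_le_one hρ]
          exact hx
  nlinarith [h.nonneg ρ]

lemma sublevel_subset (h : IsRegularPotential κ V) (hκ : 1 ≤ κ) {ρ : ℝ} (hρ : 0 < ρ) :
    {t | V t ≤ V ρ} ⊆ Set.Icc (-((4 * κ) ^ κ * ρ)) ((4 * κ) ^ κ * ρ) := by
  intro t ht
  refine abs_le.1 ?_
  by_contra! hlt
  have h1 := h.four_mul_le hκ hρ hlt.le
  have h2 := h.right.pos ρ hρ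
  have h3 : V t ≤ V ρ := ht
  linarith

lemma le_sublevelMeasure (h : IsRegularPotential κ V) (hκ : 1 ≤ κ) {ρ : ℝ} (hρ : 0 < ρ) :
    ρ ≤ sublevelMeasure V (V ρ) := by
  have h1 : Set.Ioc 0 ρ ⊆ {t | V t ≤ V ρ} := fun t ht => h.right.mono hκ ht.1 ht.2
  have h2 : (volume : Measure ℝ) {t | V t ≤ V ρ} ≠ ⊤ :=
    ((measure_mono (h.sublevel_subset hκ hρ)).trans_lt measure_Icc_lt_top).ne
  have h3 := measureReal_mono (μ := volume) h1 h2
  simpa [sublevelMeasure, hρ.le] using h3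

lemma sublevelMeasure_le (h : IsRegularPotential κ V) (hκ : 1 ≤ κ) {ρ : ℝ} (hρ : 0 < ρ) :
    sublevelMeasure V (V ρ) ≤ 2 * (4 * κ) ^ κ * ρ := by
  have hM := one_le_scale hκ
  have h3 := measureReal_mono (μ := volume) (h.sublevel_subset hκ hρ) measure_Icc_lt_top.ne
  rw [Real.volume_real_Icc_of_le (by nlinarith)] at h3
  exact h3.trans_eq (by ring)

end IsRegularPotential

/-! ### Real powers under comparison, and power weights. -/

lemma Real.rpow_le_of_ratio {A p q : ℝ} (hA : 1 ≤ A) (hp : 0 < p) (hq : 0 < q)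
    (h₁ : p ≤ A * q) (h₂ : q ≤ A * p) (r : ℝ) : p ^ r ≤ A ^ |r| * q ^ r := by
  rcases le_or_gt 0 r with hr | hr
  · rw [abs_of_nonneg hr, ← Real.mul_rpow (by linarith) hq.le]
    exact Real.rpow_le_rpow hp.le h₁ hr
  · rw [abs_of_neg hr, Real.rpow_neg (by linarith), ← Real.inv_rpow (by linarith),
      ← Real.mul_rpow (by positivity) hq.le]
    refine Real.rpow_le_rpow_of_nonpos (by positivity) ?_ hr.le
    rw [inv_mul_le_iff₀ (by linarith)]
    exact h₂

namespace IsRegularPotential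

variable {κ : ℝ} {V : ℝ → ℝ}

/-- The worst exponent depends on the sign of `b`: the slowest growth rate `κ⁻¹` of `V` governs `b ≥
0`, the fastest rate `κ` governs `b < 0`. The minimum records both cases. -/
lemma rpow_le (h : IsRegularPotential κ V) (hκ : 1 ≤ κ) (b : ℝ) {t x : ℝ} (ht : t ≠ 0)
    (htx : |t| ≤ |x|) :
    V t ^ b ≤ κ ^ |b| * (|t| / |x|) ^ min (κ⁻¹ * b) (κ * b) * V x ^ b := by
  have hκ0 : 0 < κ := by linarith
  have hκi : κ⁻¹ ≤ κ := (inv_le_one_of_one_le₀ hκ).trans hκ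
  have ht0 : 0 < |t| := abs_pos.2 ht
  have hx0 : 0 < |x| := ht0.trans_le htx
  have hVt := h.pos ht
  have hVx := h.pos (abs_pos.1 hx0)
  rcases le_or_gt 0 b with hb | hb
  · rw [min_eq_left (mul_le_mul_of_nonneg_right hκi hb), abs_of_nonneg hb, Real.rpow_mul
      (by positivity), ← Real.mul_rpow (by positivity) (by positivity),
      ← Real.mul_rpow (by positivity) (by positivity)]
    exact Real.rpow_le_rpow hVt.le (h.le_of_abs_le' hκ ht htx) hb
  · rw [min_eq_right (mul_le_mul_of_nonpos_right hκi hb.le), abs_of_neg hb, Real.rpow_mul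
      (by positivity), Real.rpow_neg (by linarith), ← Real.inv_rpow (by linarith),
      ← Real.mul_rpow (by positivity) (by positivity),
      ← Real.mul_rpow (by positivity) (by positivity)]
    refine Real.rpow_le_rpow_of_nonpos (by positivity) ?_ hb.le
    have h1 := h.le_of_abs_le hκ ht htx
    rw [mul_assoc, inv_mul_le_iff₀ hκ0, ← inv_div, Real.inv_rpow (by positivity),
      inv_mul_le_iff₀ (by positivity)]
    exact h1.trans_eq (by ring)

lemma lintegral_abs_rpow_Icc {p x : ℝ} (hp : -1 < p) (hx : 0 ≤ x) :
    ∫⁻ t in Set.Icc (-x) x, ENNReal.ofReal (|t| ^ p)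
      ≤ ENNReal.ofReal (2 * (x ^ (p + 1) / (p + 1))) := by
  have hpos : ∫⁻ t in Set.Ioc 0 x, ENNReal.ofReal (|t| ^ p)
      = ENNReal.ofReal (x ^ (p + 1) / (p + 1)) := by
    have hint : IntegrableOn (fun t : ℝ => t ^ p) (Set.Ioc 0 x) :=
      (intervalIntegrable_iff_integrableOn_Ioc_of_le hx).1
        (intervalIntegral.intervalIntegrable_rpow' hp)
    have h1 : ∫⁻ t in Set.Ioc 0 x, ENNReal.ofReal (|t| ^ p)
        = ∫⁻ t in Set.Ioc 0 x, ENNReal.ofReal (t ^ p) :=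
      setLIntegral_congr_fun measurableSet_Ioc (fun t ht => by
        simp only [abs_of_pos ht.1])
    rw [h1, ← ofReal_integral_eq_lintegral_ofReal hint, ← intervalIntegral.integral_of_le hx,
      integral_rpow (Or.inl hp), Real.zero_rpow (by linarith), sub_zero]
    filter_upwards [ae_restrict_mem measurableSet_Ioc] with t ht
    exact Real.rpow_nonneg ht.1.le p
  have hneg : ∫⁻ t in Set.Ico (-x) 0, ENNReal.ofReal (|t| ^ p)
      = ∫⁻ t in Set.Ioc 0 x, ENNReal.ofReal (|t| ^ p) := by
    have := (Measure.measurePreserving_neg (volume : Measure ℝ)).setLIntegral_comp_preimage_emb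
      (MeasurableEquiv.neg ℝ).measurableEmbedding (fun t => ENNReal.ofReal (|t| ^ p))
      (Set.Ioc 0 x)
    simpa using this
  have hsub : Set.Icc (-x) x ⊆ Set.Ico (-x) 0 ∪ {0} ∪ Set.Ioc 0 x := by
    intro t ht
    rcases lt_trichotomy t 0 with h | h | h
    · exact Or.inl (Or.inl ⟨ht.1, h⟩)
    · exact Or.inl (Or.inr h)
    · exact Or.inr ⟨h, ht.2⟩
  calc _ ≤ ∫⁻ t in Set.Ico (-x) 0 ∪ {0} ∪ Set.Ioc 0 x, ENNReal.ofReal (|t| ^ p) :=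
        lintegral_mono_set hsub
    _ ≤ (∫⁻ t in Set.Ico (-x) 0 ∪ {0}, ENNReal.ofReal (|t| ^ p)) +
          ∫⁻ t in Set.Ioc 0 x, ENNReal.ofReal (|t| ^ p) := lintegral_union_le _ _ _
    _ ≤ ((∫⁻ t in Set.Ico (-x) 0, ENNReal.ofReal (|t| ^ p)) +
          ∫⁻ t in {0}, ENNReal.ofReal (|t| ^ p)) +
          ∫⁻ t in Set.Ioc 0 x, ENNReal.ofReal (|t| ^ p) :=
        add_le_add_left (lintegral_union_le _ _ _) _
    _ = _ := by
        have h0 : (0:ℝ) ≤ x ^ (p + 1) / (p + 1) :=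
          div_nonneg (Real.rpow_nonneg hx _) (by linarith)
        rw [hneg, hpos, setLIntegral_measure_zero _ _ (by simp), add_zero,
          ← ENNReal.ofReal_add h0 h0, two_mul]

theorem exists_isDominatedWeight (hκ : 1 ≤ κ) {a b : ℝ}
    (hab : -1 < a + min (κ⁻¹ * b) (κ * b)) : ∃ C : ℝ, 0 < C ∧
      ∀ V : ℝ → ℝ, IsRegularPotential κ V →
        IsDominatedWeight V a b C (fun x => |x| ^ a * V x ^ b) := by
  have hκ0 : 0 < κ := by linarith
  set m := min (κ⁻¹ * b) (κ * b) with hm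
  -- The `1` serves the pointwise bound; the other entry comes from integrating `|t| ^ (a + m)` over
  -- `[-|x|, |x|]`, where `a + m > -1` gives convergence at `0`.
  refine ⟨max 1 (κ ^ |b| * (2 / (a + m + 1))), by positivity, fun V h => ⟨?_, ?_⟩⟩
  · intro x hx
    have := Real.rpow_nonneg (h.nonneg x) b
    rw [mul_assoc]
    exact le_mul_of_one_le_left (by positivity) (le_max_left _ _)
  · intro x hx
    have hx0 : 0 < |x| := abs_pos.2 hx
    have hVx := h.pos hx
    have hB : 0 ≤ κ ^ |b| * |x| ^ (-m) * V x ^ b := by positivity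
    calc ∫⁻ t in Set.Icc (-|x|) |x|, ENNReal.ofReal (|t| ^ a * V t ^ b)
        ≤ ∫⁻ t in Set.Icc (-|x|) |x|, ENNReal.ofReal (κ ^ |b| * |x| ^ (-m) * V x ^ b)
            * ENNReal.ofReal (|t| ^ (a + m)) := by
          refine lintegral_mono_ae ?_
          have hne : ∀ᵐ t ∂(volume.restrict (Set.Icc (-|x|) |x|)), t ≠ (0 : ℝ) :=
            ae_restrict_of_ae (by simp [ae_iff])
          filter_upwards [hne, ae_restrict_mem measurableSet_Icc] with t ht htx
          rw [← ENNReal.ofReal_mul hB]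
          refine ENNReal.ofReal_le_ofReal ?_
          have ht0 : 0 < |t| := abs_pos.2 ht
          have h1 := h.rpow_le hκ b ht (abs_le.2 htx)
          rw [← hm, Real.div_rpow ht0.le hx0.le] at h1
          calc |t| ^ a * V t ^ b
              ≤ |t| ^ a * (κ ^ |b| * (|t| ^ m / |x| ^ m) * V x ^ b) := by gcongr
            _ = _ := by
              rw [Real.rpow_add ht0, Real.rpow_neg hx0.le]
              ring
      _ = ENNReal.ofReal (κ ^ |b| * |x| ^ (-m) * V x ^ b) *
            ∫⁻ t in Set.Icc (-|x|) |x|, ENNReal.ofReal (|t| ^ (a + m)) :=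
          lintegral_const_mul' _ _ ENNReal.ofReal_ne_top
      _ ≤ ENNReal.ofReal (κ ^ |b| * |x| ^ (-m) * V x ^ b) *
            ENNReal.ofReal (2 * (|x| ^ (a + m + 1) / (a + m + 1))) := by
          gcongr
          exact lintegral_abs_rpow_Icc hab hx0.le
      _ ≤ _ := by
          rw [← ENNReal.ofReal_mul hB]
          refine ENNReal.ofReal_le_ofReal ?_
          calc _ = κ ^ |b| * (2 / (a + m + 1)) * (|x| ^ (-m) * |x| ^ (a + m + 1)) * V x ^ b := by
                ring
            _ = κ ^ |b| * (2 / (a + m + 1)) * |x| ^ (a + 1) * V x ^ b := by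
                rw [← Real.rpow_add hx0]
                congr 3
                ring
            _ ≤ _ := by
                gcongr
                exact le_max_right _ _

end IsRegularPotential

/-! ### A priori estimates for square-integrable solutions. -/

lemma MeasureTheory.Integrable.exists_lt_of_pos {f : ℝ → ℝ} (hf : Integrable f) (y : ℝ) {ε : ℝ}
    (hε : 0 < ε) : ∃ t, y ≤ t ∧ f t < ε := by
  by_contra! H
  have h1 : IntegrableOn (fun _ : ℝ => ε) (Set.Ici y) := by
    refine Integrable.mono' (hf.integrableOn (s := Set.Ici y)) (by fun_prop) ?_
    filter_upwards [ae_restrict_mem measurableSet_Ici] with t ht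
    rw [Real.norm_of_nonneg hε.le]
    exact H t ht
  rw [integrableOn_const_iff] at h1
  simp [hε.ne'] at h1

/-- A real, square-integrable solution of `-ψ'' + V ψ = E ψ` with `L²` norm `1`. -/
structure IsUnitSolution (V : ℝ → ℝ) (E : ℝ) (ψ : ℝ → ℝ) : Prop where
  contDiff : ContDiff ℝ 2 ψ
  equation : ∀ x : ℝ, -deriv (deriv ψ) x + V x * ψ x = E * ψ x
  integrable_sq : Integrable (fun x => ψ x ^ 2)
  norm_eq_one : ∫ x, ψ x ^ 2 = 1

lemma IsNormalizedEigenfunction.isUnitSolution {V : ℝ → ℝ} {E : ℝ} {ψ : ℝ → ℝ}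
    (h : IsNormalizedEigenfunction V E ψ) : IsUnitSolution V E ψ :=
  ⟨h.contDiff, h.equation, h.integrable_sq, h.norm_eq_one⟩

namespace IsUnitSolution

variable {κ : ℝ} {V : ℝ → ℝ} {E : ℝ} {ψ : ℝ → ℝ}

lemma hasDerivAt (S : IsUnitSolution V E ψ) (x : ℝ) : HasDerivAt ψ (deriv ψ x) x :=
  (S.contDiff.differentiable two_ne_zero x).hasDerivAt

lemma contDiff_deriv (S : IsUnitSolution V E ψ) : ContDiff ℝ 1 (deriv ψ) :=
  ((contDiff_succ_iff_deriv (n := 1)).1 (by simpa [one_add_one_eq_two] using S.contDiff)).2.2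

lemma continuous_deriv (S : IsUnitSolution V E ψ) : Continuous (deriv ψ) :=
  S.contDiff_deriv.continuous

lemma continuous (S : IsUnitSolution V E ψ) : Continuous ψ := S.contDiff.continuous

lemma hasDerivAt_deriv (S : IsUnitSolution V E ψ) (x : ℝ) :
    HasDerivAt (deriv ψ) ((V x - E) * ψ x) x := by
  refine (S.contDiff_deriv.differentiable one_ne_zero x).hasDerivAt.congr_deriv ?_
  linarith [S.equation x]

lemma hasDerivAt_sq (S : IsUnitSolution V E ψ) (x : ℝ) :
    HasDerivAt (fun y => ψ y ^ 2) (2 * (ψ x * deriv ψ x)) x := by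
  refine ((S.hasDerivAt x).pow 2).congr_deriv ?_
  ring

lemma hasDerivAt_mul_deriv (S : IsUnitSolution V E ψ) (x : ℝ) :
    HasDerivAt (fun y => ψ y * deriv ψ y) (deriv ψ x ^ 2 + (V x - E) * ψ x ^ 2) x := by
  refine ((S.hasDerivAt x).mul (S.hasDerivAt_deriv x)).congr_deriv ?_
  ring

lemma hasDerivAt_deriv_sq (S : IsUnitSolution V E ψ) (x : ℝ) :
    HasDerivAt (fun y => deriv ψ y ^ 2) (2 * (V x - E) * (ψ x * deriv ψ x)) x := by
  refine ((S.hasDerivAt_deriv x).pow 2).congr_deriv ?_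
  ring

lemma deriv_comp_neg' (ψ : ℝ → ℝ) : deriv (fun x => ψ (-x)) = fun x => -deriv ψ (-x) :=
  funext fun x => deriv_comp_neg ψ x

/-- Positivity near `+∞` is not preserved by reflection, which is why `IsUnitSolution` omits it;
estimates on the negative half-line then follow from those on the positive one. -/
lemma reflect (S : IsUnitSolution V E ψ) :
    IsUnitSolution (fun x => V (-x)) E (fun x => ψ (-x)) where
  contDiff := S.contDiff.comp contDiff_neg
  equation x := by
    rw [deriv_comp_neg', deriv.fun_neg, deriv_comp_neg, neg_neg]
    exact S.equation (-x)
  integrable_sq := S.integrable_sq.comp_neg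
  norm_eq_one := (integral_neg_eq_self (fun x => ψ x ^ 2) volume).trans S.norm_eq_one

/-- In the forbidden region `(ψψ')' = ψ'² + (V - E)ψ² ≥ 0`. A positive value `d` of `ψψ'` would
persist and make `ψ²` grow at rate at least `2d`, contradicting square-integrability. -/
lemma mul_deriv_nonpos (S : IsUnitSolution V E ψ) {y : ℝ} (hy : ∀ t, y ≤ t → E ≤ V t) :
    ψ y * deriv ψ y ≤ 0 := by
  by_contra! hd
  set d := ψ y * deriv ψ y with hd'
  have hmono : MonotoneOn (fun t => ψ t * deriv ψ t) (Set.Ici y) := by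
    refine monotoneOn_of_deriv_nonneg (convex_Ici y)
      (fun x _ => (S.hasDerivAt_mul_deriv x).continuousAt.continuousWithinAt)
      (fun x _ => (S.hasDerivAt_mul_deriv x).differentiableAt.differentiableWithinAt) ?_
    intro x hx
    rw [interior_Ici] at hx
    rw [(S.hasDerivAt_mul_deriv x).deriv]
    have := mul_nonneg (sub_nonneg.2 (hy x (le_of_lt hx))) (sq_nonneg (ψ x))
    positivity
  have hlin : MonotoneOn (fun t => ψ t ^ 2 - 2 * d * t) (Set.Ici y) := by
    have hder : ∀ x, HasDerivAt (fun t => ψ t ^ 2 - 2 * d * t)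
        (2 * (ψ x * deriv ψ x) - 2 * d * 1) x := fun x =>
      (S.hasDerivAt_sq x).sub ((hasDerivAt_id x).const_mul (2 * d))
    refine monotoneOn_of_deriv_nonneg (convex_Ici y)
      (fun x _ => (hder x).continuousAt.continuousWithinAt)
      (fun x _ => (hder x).differentiableAt.differentiableWithinAt) ?_
    intro x hx
    rw [interior_Ici] at hx
    rw [(hder x).deriv]
    have : d ≤ ψ x * deriv ψ x := hmono Set.self_mem_Ici (Set.Ioi_subset_Ici_self hx) (le_of_lt hx)
    linarith
  obtain ⟨t, ht, htd⟩ := S.integrable_sq.exists_lt_of_pos (y + 1) hd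
  have h1 : ψ y ^ 2 - 2 * d * y ≤ ψ t ^ 2 - 2 * d * t :=
    hlin Set.self_mem_Ici (by simp; linarith) (by linarith)
  nlinarith [sq_nonneg (ψ y)]

lemma antitoneOn_sq (S : IsUnitSolution V E ψ) {y : ℝ} (hy : ∀ t, y ≤ t → E ≤ V t) :
    AntitoneOn (fun t => ψ t ^ 2) (Set.Ici y) := by
  refine antitoneOn_of_deriv_nonpos (convex_Ici y)
    (fun x _ => (S.hasDerivAt_sq x).continuousAt.continuousWithinAt)
    (fun x _ => (S.hasDerivAt_sq x).differentiableAt.differentiableWithinAt) ?_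
  intro x hx
  rw [interior_Ici] at hx
  rw [(S.hasDerivAt_sq x).deriv]
  linarith [S.mul_deriv_nonpos (y := x) (fun t ht => hy t ((le_of_lt hx).trans ht))]

lemma antitoneOn_deriv_sq (S : IsUnitSolution V E ψ) {y : ℝ} (hy : ∀ t, y ≤ t → E ≤ V t) :
    AntitoneOn (fun t => deriv ψ t ^ 2) (Set.Ici y) := by
  refine antitoneOn_of_deriv_nonpos (convex_Ici y)
    (fun x _ => (S.hasDerivAt_deriv_sq x).continuousAt.continuousWithinAt)
    (fun x _ => (S.hasDerivAt_deriv_sq x).differentiableAt.differentiableWithinAt) ?_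
  intro x hx
  rw [interior_Ici] at hx
  rw [(S.hasDerivAt_deriv_sq x).deriv]
  have h1 := S.mul_deriv_nonpos (y := x) (fun t ht => hy t ((le_of_lt hx).trans ht))
  have h2 := hy x (le_of_lt hx)
  exact mul_nonpos_of_nonneg_of_nonpos (by linarith) h1

lemma mul_deriv_nonneg (S : IsUnitSolution V E ψ) {y : ℝ} (hy : ∀ t, t ≤ y → E ≤ V t) :
    0 ≤ ψ y * deriv ψ y := by
  have := S.reflect.mul_deriv_nonpos (y := -y) (fun t ht => hy (-t) (by linarith))
  rw [deriv_comp_neg'] at this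
  simp only [neg_neg] at this
  linarith

/-- If `E ≤ 0`, the whole line is forbidden from both ends, so `ψψ' = 0` and `ψ²` is constant. -/
lemma energy_pos (S : IsUnitSolution V E ψ) (hV : ∀ x, 0 ≤ V x) : 0 < E := by
  by_contra! hE
  have h0 : ∀ x, ψ x * deriv ψ x = 0 := fun x => le_antisymm
    (S.mul_deriv_nonpos fun t _ => hE.trans (hV t)) (S.mul_deriv_nonneg fun t _ => hE.trans (hV t))
  have hc : ∀ x, ψ x ^ 2 = ψ 0 ^ 2 := fun x =>
    is_const_of_deriv_eq_zero (fun x => (S.hasDerivAt_sq x).differentiableAt)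
      (fun x => by rw [(S.hasDerivAt_sq x).deriv, h0, mul_zero]) x 0
  have h1 := S.norm_eq_one
  simp only [hc] at h1
  -- The real-valued measure of the line is `0` by convention, so the integral of a constant is `0`,
  -- not `1`.
  simp [Measure.real] at h1

lemma integral_energy (S : IsUnitSolution V E ψ) (hVc : Continuous V) (a b : ℝ) :
    ∫ x in a..b, (deriv ψ x ^ 2 + (V x - E) * ψ x ^ 2)
      = ψ b * deriv ψ b - ψ a * deriv ψ a := by
  have h1 := S.continuous
  have h2 := S.continuous_deriv
  refine intervalIntegral.integral_eq_sub_of_hasDerivAt (fun x _ => S.hasDerivAt_mul_deriv x) ?_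
  exact Continuous.intervalIntegrable (by fun_prop) _ _

/-- Integrate `(ψψ')'` over `[-R, R]`: for large `R` the boundary terms have a favourable sign, so
they need not be shown to vanish. -/
lemma integrable_energy (S : IsUnitSolution V E ψ) (h : IsRegularPotential κ V) (hκ : 1 ≤ κ) :
    Integrable (fun x => deriv ψ x ^ 2 + V x * ψ x ^ 2) ∧
      ∫ x, (deriv ψ x ^ 2 + V x * ψ x ^ 2) ≤ E := by
  have hE := S.energy_pos h.nonneg
  have hVc := h.continuous hκ
  have hψ := S.continuous
  have hψ' := S.continuous_deriv
  obtain ⟨ρ, hρ, hρE⟩ := h.exists_eq hκ hE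
  have hM := IsRegularPotential.one_le_scale hκ
  have hlarge : ∀ t, (4 * κ) ^ κ * ρ ≤ |t| → E ≤ V t := fun t ht => by
    linarith [h.four_mul_le hκ hρ ht]
  set f := fun x => deriv ψ x ^ 2 + V x * ψ x ^ 2 with hf
  have hfc : Continuous f := by fun_prop
  have hf0 : ∀ x, 0 ≤ f x := fun x =>
    add_nonneg (sq_nonneg _) (mul_nonneg (h.nonneg x) (sq_nonneg _))
  have hbound : ∀ R, (4 * κ) ^ κ * ρ ≤ R → ∫ x in (-R)..R, f x ≤ E := by
    intro R hR
    have hR0 : 0 ≤ R := le_trans (by positivity) hR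
    have h1 := S.integral_energy hVc (-R) R
    have h2 := S.mul_deriv_nonpos (y := R) (fun t ht => hlarge t
      (hR.trans (ht.trans (le_abs_self t))))
    have h3 := S.mul_deriv_nonneg (y := -R) (fun t ht => hlarge t
      (hR.trans ((by linarith : R ≤ -t).trans (neg_le_abs t))))
    have h4 : ∫ x in (-R)..R, ψ x ^ 2 ≤ 1 := by
      rw [intervalIntegral.integral_of_le (by linarith), ← S.norm_eq_one]
      exact setIntegral_le_integral S.integrable_sq (Eventually.of_forall fun x => sq_nonneg _)
    have h5 : ∫ x in (-R)..R, (deriv ψ x ^ 2 + (V x - E) * ψ x ^ 2)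
        = (∫ x in (-R)..R, f x) - E * ∫ x in (-R)..R, ψ x ^ 2 := by
      rw [← intervalIntegral.integral_const_mul, ← intervalIntegral.integral_sub
        (hfc.intervalIntegrable _ _) (Continuous.intervalIntegrable (by fun_prop) _ _)]
      refine intervalIntegral.integral_congr fun x _ => ?_
      simp only [hf]
      ring
    nlinarith
  have hint : Integrable f := by
    refine integrable_of_intervalIntegral_norm_bounded (l := atTop) (a := fun R : ℝ => -R)
      (b := fun R => R) E (fun R => hfc.integrableOn_Ioc) tendsto_neg_atTop_atBot tendsto_id ?_
    filter_upwards [eventually_ge_atTop ((4 * κ) ^ κ * ρ)] with R hR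
    simpa only [Real.norm_of_nonneg (hf0 _)] using hbound R hR
  refine ⟨hint, le_of_tendsto (intervalIntegral_tendsto_integral hint tendsto_neg_atTop_atBot
    tendsto_id) ?_⟩
  filter_upwards [eventually_ge_atTop ((4 * κ) ^ κ * ρ)] with R hR using hbound R hR

lemma integrable_deriv_sq (S : IsUnitSolution V E ψ) (h : IsRegularPotential κ V) (hκ : 1 ≤ κ) :
    Integrable (fun x => deriv ψ x ^ 2) := by
  refine (S.integrable_energy h hκ).1.mono' (by have := S.continuous_deriv; fun_prop) ?_
  refine Eventually.of_forall fun x => ?_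
  rw [Real.norm_of_nonneg (sq_nonneg _)]
  exact le_add_of_nonneg_right (mul_nonneg (h.nonneg x) (sq_nonneg _))

lemma integral_deriv_sq_le (S : IsUnitSolution V E ψ) (h : IsRegularPotential κ V)
    (hκ : 1 ≤ κ) : ∫ x, deriv ψ x ^ 2 ≤ E := by
  refine (integral_mono (S.integrable_deriv_sq h hκ) (S.integrable_energy h hκ).1
    fun x => ?_).trans (S.integrable_energy h hκ).2
  exact le_add_of_nonneg_right (mul_nonneg (h.nonneg x) (sq_nonneg _))

lemma integrable_potential_mul_sq (S : IsUnitSolution V E ψ) (h : IsRegularPotential κ V)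
    (hκ : 1 ≤ κ) : Integrable (fun x => V x * ψ x ^ 2) := by
  refine (S.integrable_energy h hκ).1.mono'
    (by have := S.continuous; have := h.continuous hκ; fun_prop) ?_
  refine Eventually.of_forall fun x => ?_
  rw [Real.norm_of_nonneg (mul_nonneg (h.nonneg x) (sq_nonneg _))]
  exact le_add_of_nonneg_left (sq_nonneg _)

lemma integral_potential_mul_sq_le (S : IsUnitSolution V E ψ) (h : IsRegularPotential κ V)
    (hκ : 1 ≤ κ) : ∫ x, V x * ψ x ^ 2 ≤ E := by
  refine (integral_mono (S.integrable_potential_mul_sq h hκ) (S.integrable_energy h hκ).1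
    fun x => ?_).trans (S.integrable_energy h hκ).2
  exact le_add_of_nonneg_left (sq_nonneg _)

/-- Write `ψ(x)²` as `ψ(R)² - ∫ 2ψψ'` with `ψ(R)²` small, and use `-2ψψ' ≤ √E ψ² + ψ'²/√E`, whose
right side has integral at most `2√E`. -/
lemma sq_le_sqrt (S : IsUnitSolution V E ψ) (h : IsRegularPotential κ V) (hκ : 1 ≤ κ) (x : ℝ) :
    ψ x ^ 2 ≤ 2 * √E := by
  have hE := S.energy_pos h.nonneg
  have hs : 0 < √E := Real.sqrt_pos.2 hE
  have hψ := S.continuous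
  have hψ' := S.continuous_deriv
  refine le_of_forall_pos_le_add fun ε hε => ?_
  obtain ⟨R, hR, hRε⟩ := S.integrable_sq.exists_lt_of_pos x hε
  set g := fun t => √E * ψ t ^ 2 + deriv ψ t ^ 2 / √E with hg
  have hgi : Integrable g :=
    (S.integrable_sq.const_mul _).add ((S.integrable_deriv_sq h hκ).div_const _)
  have hg0 : ∀ t, 0 ≤ g t := fun t => by positivity
  have h1 : ∫ t in x..R, 2 * (ψ t * deriv ψ t) = ψ R ^ 2 - ψ x ^ 2 :=
    intervalIntegral.integral_eq_sub_of_hasDerivAt (fun t _ => S.hasDerivAt_sq t)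
      (Continuous.intervalIntegrable (by fun_prop) _ _)
  have h2 : -∫ t in x..R, 2 * (ψ t * deriv ψ t) ≤ ∫ t in x..R, g t := by
    rw [← intervalIntegral.integral_neg]
    refine intervalIntegral.integral_mono_on hR (Continuous.intervalIntegrable (by fun_prop) _ _)
      hgi.intervalIntegrable fun t _ => ?_
    have : g t + 2 * (ψ t * deriv ψ t) = (√E * ψ t + deriv ψ t) ^ 2 / √E := by
      simp only [hg]
      field_simp
      ring
    have : 0 ≤ (√E * ψ t + deriv ψ t) ^ 2 / √E := by positivity
    linarith
  have h3 : ∫ t in x..R, g t ≤ ∫ t, g t := by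
    rw [intervalIntegral.integral_of_le hR]
    exact setIntegral_le_integral hgi (Eventually.of_forall hg0)
  have h4 : ∫ t, g t ≤ 2 * √E := by
    simp only [hg]
    rw [integral_add (S.integrable_sq.const_mul _) ((S.integrable_deriv_sq h hκ).div_const _),
      integral_const_mul, integral_div, S.norm_eq_one]
    have h5 : (∫ t, deriv ψ t ^ 2) / √E ≤ √E := by
      rw [div_le_iff₀ hs, Real.mul_self_sqrt hE.le]
      exact S.integral_deriv_sq_le h hκ
    linarith
  linarith

/-- The uncertainty principle: the classically allowed region has length `≳ E^{-1/2}`. -/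
lemma one_le_mul_sqrt (S : IsUnitSolution V E ψ) (h : IsRegularPotential κ V) (hκ : 1 ≤ κ)
    {ρ : ℝ} (hρ : 0 < ρ) (hρE : V ρ = E) : 1 ≤ 8 * (4 * κ) ^ κ * (ρ * √E) := by
  have hE := S.energy_pos h.nonneg
  have hM := IsRegularPotential.one_le_scale hκ
  set M := (4 * κ) ^ κ
  have hVi := S.integrable_potential_mul_sq h hκ
  set I := Set.Icc (-(M * ρ)) (M * ρ) with hI
  have hIi : Integrable (I.indicator fun _ : ℝ => 2 * √E) :=
    (integrable_indicator_iff measurableSet_Icc).2 continuous_const.integrableOn_Icc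
  -- Outside `I` one has `V ≥ 4E`, so the potential energy controls `ψ²`; inside, the sup bound
  -- does. Integrating gives `1 ≤ 1/2 + 4Mρ√E`.
  have h1 : ∫ x, ψ x ^ 2 ≤ ∫ x, (V x * ψ x ^ 2 / (2 * E) + I.indicator (fun _ => 2 * √E) x) := by
    refine integral_mono S.integrable_sq ((hVi.div_const _).add hIi) fun x => ?_
    have hV0 : 0 ≤ V x * ψ x ^ 2 / (2 * E) :=
      div_nonneg (mul_nonneg (h.nonneg x) (sq_nonneg _)) (by linarith)
    by_cases hx : x ∈ I
    · simp only [Set.indicator_of_mem hx]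
      linarith [S.sq_le_sqrt h hκ x]
    · simp only [Set.indicator_of_notMem hx, add_zero]
      have hx' : M * ρ ≤ |x| := by
        by_contra! hlt
        exact hx (abs_le.1 hlt.le)
      have := h.four_mul_le hκ hρ hx'
      rw [le_div_iff₀ (by linarith)]
      nlinarith [sq_nonneg (ψ x)]
  rw [S.norm_eq_one, integral_add (hVi.div_const _) hIi, integral_div,
    integral_indicator measurableSet_Icc, setIntegral_const,
    Real.volume_real_Icc_of_le (by nlinarith [mul_pos (zero_lt_one.trans_le hM) hρ]),
    smul_eq_mul] at h1
  have h2 : (∫ x, V x * ψ x ^ 2) / (2 * E) ≤ 1 / 2 := by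
    rw [div_le_iff₀ (by linarith)]
    linarith [S.integral_potential_mul_sq_le h hκ]
  nlinarith

end IsUnitSolution

/-! ### Monotone energies, the bulk bound and decay. -/

namespace IsUnitSolution

variable {κ : ℝ} {V : ℝ → ℝ} {E : ℝ} {ψ : ℝ → ℝ}

lemma hasDerivAt_actionEnergy (S : IsUnitSolution V E ψ) (h : IsRegularPotential κ V) {x : ℝ}
    (hx : 0 < x) : HasDerivAt (fun y => deriv ψ y ^ 2 + (E - V y) * ψ y ^ 2)
      (-(deriv V x * ψ x ^ 2)) x := by
  refine ((S.hasDerivAt_deriv_sq x).add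
    (((h.right.hasDerivAt hx).const_sub E).mul (S.hasDerivAt_sq x))).congr_deriv ?_
  ring

lemma actionEnergy_le (S : IsUnitSolution V E ψ) (h : IsRegularPotential κ V) (hκ : 1 ≤ κ)
    (x : ℝ) : deriv ψ x ^ 2 + (E - V x) * ψ x ^ 2 ≤ deriv ψ 0 ^ 2 + E * ψ 0 ^ 2 := by
  have key : ∀ {V ψ : ℝ → ℝ}, IsUnitSolution V E ψ → IsRegularPotential κ V → ∀ x, 0 ≤ x →
      deriv ψ x ^ 2 + (E - V x) * ψ x ^ 2 ≤ deriv ψ 0 ^ 2 + E * ψ 0 ^ 2 := by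
    intro V ψ S h x hx
    have hψ := S.continuous
    have hψ' := S.continuous_deriv
    have hVc := h.continuous hκ
    have hanti : AntitoneOn (fun y => deriv ψ y ^ 2 + (E - V y) * ψ y ^ 2) (Set.Ici 0) := by
      refine antitoneOn_of_deriv_nonpos (convex_Ici 0)
        (Continuous.continuousOn (by fun_prop)) ?_ ?_ <;> rw [interior_Ici]
      · exact fun y hy => (S.hasDerivAt_actionEnergy h hy).differentiableAt.differentiableWithinAt
      · intro y hy
        rw [(S.hasDerivAt_actionEnergy h hy).deriv]
        have := mul_nonneg (h.right.deriv_nonneg hκ hy) (sq_nonneg (ψ y))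
        linarith
    simpa [h.zero] using hanti Set.self_mem_Ici (Set.mem_Ici.2 hx) hx
  rcases le_total 0 x with hx | hx
  · exact key S h x hx
  · simpa [deriv_comp_neg'] using key S.reflect h.reflect (-x) (by linarith)

/-- The quotient is `ψ² + ψ'²/(E - V)`, with derivative `V'ψ'²/(E - V)² ≥ 0`. Together with
`actionEnergy_le` it pins the energy in the bulk to its value at `0`. -/
lemma le_actionEnergy (S : IsUnitSolution V E ψ) (h : IsRegularPotential κ V) (hκ : 1 ≤ κ)
    {r x : ℝ} (hr : V r < E) (hx : x ∈ Set.Icc 0 r) :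
    (deriv ψ 0 ^ 2 + E * ψ 0 ^ 2) / E ≤
      (deriv ψ x ^ 2 + (E - V x) * ψ x ^ 2) / (E - V x) := by
  have hψ := S.continuous
  have hψ' := S.continuous_deriv
  have hVc := h.continuous hκ
  have hr0 : 0 ≤ r := hx.1.trans hx.2
  have hlt : ∀ y ∈ Set.Icc 0 r, 0 < E - V y := by
    intro y hy
    rcases hy.1.eq_or_lt with rfl | hy0
    · rw [h.zero]; linarith [h.nonneg r]
    · linarith [h.right.mono hκ hy0 hy.2]
  have hder : ∀ y ∈ Set.Ioo 0 r, HasDerivAt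
      (fun y => (deriv ψ y ^ 2 + (E - V y) * ψ y ^ 2) / (E - V y))
      (deriv V y * deriv ψ y ^ 2 / (E - V y) ^ 2) y := by
    intro y hy
    refine ((S.hasDerivAt_actionEnergy h hy.1).div
      ((h.right.hasDerivAt hy.1).const_sub E) (hlt y ⟨hy.1.le, hy.2.le⟩).ne').congr_deriv ?_
    ring
  have hmono : MonotoneOn (fun y => (deriv ψ y ^ 2 + (E - V y) * ψ y ^ 2) / (E - V y))
      (Set.Icc 0 r) := by
    refine monotoneOn_of_deriv_nonneg (convex_Icc 0 r) ?_ ?_ ?_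
    · exact ContinuousOn.div (Continuous.continuousOn (by fun_prop))
        (Continuous.continuousOn (by fun_prop)) fun y hy => (hlt y hy).ne'
    · rw [interior_Icc]
      exact fun y hy => (hder y hy).differentiableAt.differentiableWithinAt
    · rw [interior_Icc]
      intro y hy
      rw [(hder y hy).deriv]
      have := h.right.deriv_nonneg hκ hy.1
      positivity
  simpa [h.zero] using hmono (Set.left_mem_Icc.2 hr0) hx hx.1

/-- The eigenfunction is spread out evenly in the bulk of the classically allowed region. -/
lemma sq_add_le_bulk (S : IsUnitSolution V E ψ) (h : IsRegularPotential κ V) (hκ : 1 ≤ κ)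
    {ρ : ℝ} (hρ : 0 < ρ) (hρE : V ρ = E) {x : ℝ} (hx : (4 * κ) ^ κ * |x| ≤ ρ) :
    ψ x ^ 2 + deriv ψ x ^ 2 / E ≤ 4 * (4 * κ) ^ κ / ρ := by
  have hE := S.energy_pos h.nonneg
  have hM := IsRegularPotential.one_le_scale hκ
  have hVx := h.four_mul_le' hκ hρ hx
  have hbulk : ∀ y, (4 * κ) ^ κ * |y| ≤ ρ → 4 * V y ≤ V ρ := fun y => h.four_mul_le' hκ hρ
  set M := (4 * κ) ^ κ
  have hM0 : 0 < M := by linarith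
  set F := deriv ψ 0 ^ 2 + E * ψ 0 ^ 2 with hF
  have hr : 0 < ρ / M := by positivity
  have hbulk' : ∀ y ∈ Set.Icc 0 (ρ / M), 4 * V y ≤ E := by
    intro y hy
    rw [← hρE]
    refine hbulk y ?_
    rw [abs_of_nonneg hy.1, mul_comm, ← le_div_iff₀ hM0]
    exact hy.2
  have hlow : ∀ y ∈ Set.Icc 0 (ρ / M), 3 / 4 * F ≤ deriv ψ y ^ 2 + E * ψ y ^ 2 := by
    intro y hy
    have hVr : V (ρ / M) < E := by linarith [hbulk' _ (Set.right_mem_Icc.2 hr.le)]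
    have hVy := hbulk' y hy
    have hVy0 := h.nonneg y
    have h1 := S.le_actionEnergy h hκ hVr hy
    rw [div_le_div_iff₀ hE (by linarith), ← hF] at h1
    have hF0 : 0 ≤ F := by positivity
    have h2 : E * (3 / 4 * F) ≤ E * (deriv ψ y ^ 2 + E * ψ y ^ 2) := by
      nlinarith [mul_nonneg hE.le (mul_nonneg hVy0 (sq_nonneg (ψ y)))]
    exact le_of_mul_le_mul_left h2 hE
  have hgi : Integrable (fun y => deriv ψ y ^ 2 + E * ψ y ^ 2) :=
    (S.integrable_deriv_sq h hκ).add (S.integrable_sq.const_mul E)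
  -- The lower bound on `[0, ρ/M]` is integrated against the total `2E`, so `F ≲ E/ρ`; since `F`
  -- sits at `0`, it then bounds both sides.
  have hFle : ρ / M * (3 / 4 * F) ≤ 2 * E := by
    calc ρ / M * (3 / 4 * F) = ∫ _ in Set.Icc 0 (ρ / M), 3 / 4 * F := by
          rw [setIntegral_const, Real.volume_real_Icc_of_le hr.le, sub_zero, smul_eq_mul]
      _ ≤ ∫ y in Set.Icc 0 (ρ / M), (deriv ψ y ^ 2 + E * ψ y ^ 2) :=
          setIntegral_mono_on continuous_const.integrableOn_Icc hgi.integrableOn measurableSet_Icc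
            hlow
      _ ≤ ∫ y, (deriv ψ y ^ 2 + E * ψ y ^ 2) :=
          setIntegral_le_integral hgi (Eventually.of_forall fun y => by positivity)
      _ ≤ 2 * E := by
          rw [integral_add (S.integrable_deriv_sq h hκ) (S.integrable_sq.const_mul E),
            integral_const_mul, S.norm_eq_one]
          linarith [S.integral_deriv_sq_le h hκ]
  have h1 := S.actionEnergy_le h hκ x
  have h2 : ψ x ^ 2 + deriv ψ x ^ 2 / E ≤ 4 / 3 * F / E := by
    rw [le_div_iff₀ hE, add_mul, div_mul_cancel₀ _ hE.ne']
    nlinarith [sq_nonneg (ψ x), sq_nonneg (deriv ψ x)]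
  refine h2.trans ?_
  rw [div_le_div_iff₀ hE hρ]
  have h3 : ρ / M * (3 / 4 * F) * M = ρ * (3 / 4 * F) := by field_simp
  have h4 := mul_le_mul_of_nonneg_right hFle hM0.le
  rw [h3] at h4
  nlinarith [mul_pos hM0 hE]

/-- Agmon-type decay of `ψ²` on a half-line where the potential exceeds the energy. -/
lemma sq_mul_exp_antitoneOn (S : IsUnitSolution V E ψ) {y μ : ℝ} (hμ : 0 < μ)
    (hV : ∀ t, y ≤ t → μ ^ 2 ≤ 2 * (V t - E)) :
    AntitoneOn (fun t => ψ t ^ 2 * Real.exp (μ * t)) (Set.Ici y) := by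
  have hEV : ∀ t, y ≤ t → E ≤ V t := fun t ht => by nlinarith [hV t ht, sq_nonneg μ]
  -- With `v = ψ²`, the hypothesis gives `v'' ≥ μ²v`, so `(v' + μv)e^{-μt}` increases. As `v' ≤ 0`
  -- and `v` is bounded, it lies below a function tending to `0`, so it is nonpositive and `v
  -- e^{μt}` decreases.
  have hder : ∀ t, HasDerivAt
      (fun t => (2 * (ψ t * deriv ψ t) + μ * ψ t ^ 2) * Real.exp (-μ * t))
      ((2 * deriv ψ t ^ 2 + (2 * (V t - E) - μ ^ 2) * ψ t ^ 2) * Real.exp (-μ * t)) t := by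
    intro t
    refine ((((S.hasDerivAt_mul_deriv t).const_mul 2).add ((S.hasDerivAt_sq t).const_mul μ)).mul
      (((hasDerivAt_id t).const_mul (-μ)).exp)).congr_deriv ?_
    simp only [id, Pi.add_apply]
    ring
  have hmono : MonotoneOn
      (fun t => (2 * (ψ t * deriv ψ t) + μ * ψ t ^ 2) * Real.exp (-μ * t)) (Set.Ici y) := by
    refine monotoneOn_of_deriv_nonneg (convex_Ici y)
      (fun t _ => (hder t).continuousAt.continuousWithinAt)
      (fun t _ => (hder t).differentiableAt.differentiableWithinAt) ?_
    intro t ht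
    rw [interior_Ici] at ht
    rw [(hder t).deriv]
    have := mul_nonneg (sub_nonneg.2 (hV t (le_of_lt ht))) (sq_nonneg (ψ t))
    positivity
  have hneg : ∀ t, y ≤ t → 2 * (ψ t * deriv ψ t) + μ * ψ t ^ 2 ≤ 0 := by
    intro t ht
    have hlim : Tendsto (fun s => μ * ψ y ^ 2 * Real.exp (-μ * s)) atTop (𝓝 0) := by
      have h1 : Tendsto (fun s : ℝ => -μ * s) atTop atBot :=
        tendsto_id.const_mul_atTop_of_neg (by linarith)
      simpa using (Real.tendsto_exp_atBot.comp h1).const_mul (μ * ψ y ^ 2)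
    have h2 : (2 * (ψ t * deriv ψ t) + μ * ψ t ^ 2) * Real.exp (-μ * t) ≤ 0 := by
      refine ge_of_tendsto hlim ?_
      filter_upwards [eventually_ge_atTop t] with s hs
      refine (hmono (Set.mem_Ici.2 ht) (Set.mem_Ici.2 (ht.trans hs)) hs).trans ?_
      refine mul_le_mul_of_nonneg_right ?_ (Real.exp_pos _).le
      have h3 := S.mul_deriv_nonpos (y := s) fun r hr => hEV r ((ht.trans hs).trans hr)
      have h4 : ψ s ^ 2 ≤ ψ y ^ 2 :=
        S.antitoneOn_sq hEV Set.self_mem_Ici (Set.mem_Ici.2 (ht.trans hs)) (ht.trans hs)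
      nlinarith
    exact nonpos_of_mul_nonpos_left h2 (Real.exp_pos _)
  have hder' : ∀ t, HasDerivAt (fun t => ψ t ^ 2 * Real.exp (μ * t))
      ((2 * (ψ t * deriv ψ t) + μ * ψ t ^ 2) * Real.exp (μ * t)) t := by
    intro t
    refine ((S.hasDerivAt_sq t).mul (((hasDerivAt_id t).const_mul μ).exp)).congr_deriv ?_
    simp only [id]
    ring
  refine antitoneOn_of_deriv_nonpos (convex_Ici y)
    (fun t _ => (hder' t).continuousAt.continuousWithinAt)
    (fun t _ => (hder' t).differentiableAt.differentiableWithinAt) ?_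
  intro t ht
  rw [interior_Ici] at ht
  rw [(hder' t).deriv]
  exact mul_nonpos_of_nonpos_of_nonneg (hneg t (le_of_lt ht)) (Real.exp_pos _).le

/-- The mean value theorem gives a point `ξ` with controlled slope, and `ψ'²` is decreasing beyond
it. -/
lemma deriv_sq_mul_le (S : IsUnitSolution V E ψ) {y x : ℝ} (hyx : y < x)
    (hV : ∀ t, y ≤ t → E ≤ V t) : deriv ψ x ^ 2 * (x - y) ^ 2 ≤ 4 * ψ y ^ 2 := by
  obtain ⟨ξ, hξ, hξ'⟩ := exists_deriv_eq_slope ψ hyx S.continuous.continuousOn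
    (fun t _ => (S.hasDerivAt t).differentiableAt.differentiableWithinAt)
  have hyx' : 0 < x - y := sub_pos.2 hyx
  have h1 : deriv ψ x ^ 2 ≤ deriv ψ ξ ^ 2 :=
    S.antitoneOn_deriv_sq hV (Set.mem_Ici.2 hξ.1.le) (Set.mem_Ici.2 hyx.le) hξ.2.le
  have h2 : ψ x ^ 2 ≤ ψ y ^ 2 :=
    S.antitoneOn_sq hV Set.self_mem_Ici (Set.mem_Ici.2 hyx.le) hyx.le
  have h3 : deriv ψ ξ * (x - y) = ψ x - ψ y := by rw [hξ']; field_simp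
  calc deriv ψ x ^ 2 * (x - y) ^ 2 ≤ deriv ψ ξ ^ 2 * (x - y) ^ 2 := by gcongr
    _ = (ψ x - ψ y) ^ 2 := by rw [← mul_pow, h3]
    _ ≤ 4 * ψ y ^ 2 := by nlinarith [sq_nonneg (ψ x + ψ y)]

lemma sq_mul_sub_le_one (S : IsUnitSolution V E ψ) {w y : ℝ} (hwy : w ≤ y)
    (hV : ∀ t, w ≤ t → E ≤ V t) : ψ y ^ 2 * (y - w) ≤ 1 := by
  calc ψ y ^ 2 * (y - w) = ∫ _ in Set.Icc w y, ψ y ^ 2 := by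
        rw [setIntegral_const, Real.volume_real_Icc_of_le hwy, smul_eq_mul, mul_comm]
    _ ≤ ∫ t in Set.Icc w y, ψ t ^ 2 :=
        setIntegral_mono_on continuous_const.integrableOn_Icc S.integrable_sq.integrableOn
          measurableSet_Icc fun t ht => S.antitoneOn_sq hV ht.1 hwy ht.2
    _ ≤ 1 := by
        rw [← S.norm_eq_one]
        exact setIntegral_le_integral S.integrable_sq (Eventually.of_forall fun t => sq_nonneg _)

end IsUnitSolution

/-! ### Pointwise bounds in the tail. -/

/-- Since `η ^ κ = 1/2`, shrinking by `η` at most halves `V`. Along `w = η²x < y = ηx < z = (1+η)x/2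
< x`, the interval `[w, y]` bounds `ψ(y)²` by the total mass, `[y, z]` yields the exponential, and
`[z, x]` controls `ψ'`. -/
lemma exists_sq_add_le_tail {κ : ℝ} (hκ : 1 ≤ κ) : ∃ K c : ℝ, 0 < K ∧ 0 < c ∧
    ∀ {V ψ : ℝ → ℝ} {E : ℝ}, IsRegularPotential κ V → IsUnitSolution V E ψ →
      ∀ x, 4 * E ≤ V x →
        ψ x ^ 2 + deriv ψ x ^ 2 / E ≤ K / |x| * Real.exp (-c * |x| * √(V x)) := by
  have hκ0 : 0 < κ := by linarith
  have hM := IsRegularPotential.one_le_scale hκ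
  set M := (4 * κ) ^ κ with hM'
  set η : ℝ := (2⁻¹ : ℝ) ^ κ⁻¹ with hη
  have hη0 : 0 < η := by positivity
  have hη1 : η < 1 := Real.rpow_lt_one (by norm_num) (by norm_num) (by positivity)
  have hηκ : η ^ κ = 2⁻¹ := Real.rpow_inv_rpow (by norm_num) hκ0.ne'
  have hη1' : 0 < 1 - η := sub_pos.2 hη1
  refine ⟨(1 + 1024 * M ^ 2 / (1 - η) ^ 2) / (η * (1 - η)), (1 - η) / 4, by positivity,
    by positivity, ?_⟩
  have key : ∀ {V ψ : ℝ → ℝ} {E : ℝ}, IsRegularPotential κ V → IsUnitSolution V E ψ →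
      ∀ x, 0 < x → 4 * E ≤ V x → ψ x ^ 2 + deriv ψ x ^ 2 / E ≤
        (1 + 1024 * M ^ 2 / (1 - η) ^ 2) / (η * (1 - η)) / x *
          Real.exp (-((1 - η) / 4) * x * √(V x)) := by
    intro V ψ E h S x hx hVx
    have hE := S.energy_pos h.nonneg
    have hdil : ∀ t, 0 < t → V t ≤ 2 * V (η * t) := by
      intro t ht
      have := h.right.le_rpow_mul (s := η * t) (t := t) (by positivity) (by nlinarith)
      rwa [mul_comm η t, div_mul_cancel_left₀ ht.ne', Real.inv_rpow hη0.le, hηκ, inv_inv,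
        mul_comm t η] at this
    have hy0 : 0 < η * x := by positivity
    have hVy := hdil x hx
    have hVw := hdil _ hy0
    set y := η * x with hy
    set w := η * y with hw
    have hw0 : 0 < w := by positivity
    have hwy : w ≤ y := by nlinarith
    set z := (1 + η) / 2 * x with hz
    have hyz : y ≤ z := by nlinarith
    have hzx : z < x := by nlinarith
    have hEw : ∀ t, w ≤ t → E ≤ V t := fun t ht => by
      linarith [h.right.mono hκ hw0 ht]
    have hEz : ∀ t, z ≤ t → E ≤ V t := fun t ht => hEw t (hwy.trans (hyz.trans ht))
    have hVx0 : 0 < V x := by linarith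
    have hs : 0 < √(V x) := Real.sqrt_pos.2 hVx0
    have hss : √(V x) ^ 2 = V x := Real.sq_sqrt hVx0.le
    have hdecay := S.sq_mul_exp_antitoneOn (y := y) (μ := √(V x) / 2) (by positivity)
      (fun t ht => by
        have := h.right.mono hκ hy0 ht
        rw [div_pow, hss]
        linarith) Set.self_mem_Ici (Set.mem_Ici.2 hyz) hyz
    have huy : ψ y ^ 2 ≤ 1 / (η * (1 - η)) / x := by
      rw [div_div, le_div_iff₀ (by positivity)]
      refine le_of_eq_of_le ?_ (S.sq_mul_sub_le_one hwy hEw)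
      rw [hw, hy]
      ring
    have huz : ψ z ^ 2 ≤ 1 / (η * (1 - η)) / x * Real.exp (-((1 - η) / 4) * x * √(V x)) := by
      have h1 : ψ z ^ 2 ≤ ψ y ^ 2 * Real.exp (-((1 - η) / 4) * x * √(V x)) := by
        have h2 : -((1 - η) / 4) * x * √(V x) = √(V x) / 2 * y - √(V x) / 2 * z := by
          rw [hz, hy]
          ring
        rw [h2, Real.exp_sub, ← mul_div_assoc, le_div_iff₀ (Real.exp_pos _)]
        exact hdecay
      exact h1.trans (mul_le_mul_of_nonneg_right huy (Real.exp_pos _).le)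
    have hux : ψ x ^ 2 ≤ ψ z ^ 2 :=
      S.antitoneOn_sq hEz Set.self_mem_Ici (Set.mem_Ici.2 hzx.le) hzx.le
    have hder := S.deriv_sq_mul_le hzx hEz
    obtain ⟨ρ, hρ, hρE⟩ := h.exists_eq hκ hE
    have hρx : ρ ≤ x := by
      by_contra! hlt
      linarith [h.right.mono hκ hx hlt.le]
    -- The uncertainty principle with `ρ ≤ x` turns the factor `1/(E x²)` from the derivative bound
    -- into a constant.
    have hunc : 1 ≤ 64 * M ^ 2 * (E * x ^ 2) := by
      have h1 := S.one_le_mul_sqrt h hκ hρ hρE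
      rw [← hM'] at h1
      have hsE : 0 < √E := Real.sqrt_pos.2 hE
      have h2 : 1 ≤ 8 * M * (x * √E) := h1.trans (by gcongr)
      calc (1 : ℝ) ≤ (8 * M * (x * √E)) ^ 2 := one_le_pow₀ h2
        _ = 64 * M ^ 2 * (√E ^ 2 * x ^ 2) := by ring
        _ = _ := by rw [Real.sq_sqrt hE.le]
    have hder' : deriv ψ x ^ 2 / E ≤ 1024 * M ^ 2 / (1 - η) ^ 2 * ψ z ^ 2 := by
      rw [div_le_iff₀ hE]
      have h1 : x - z = (1 - η) / 2 * x := by rw [hz]; ring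
      have h3 : deriv ψ x ^ 2 * ((1 - η) ^ 2 * x ^ 2) ≤ 16 * ψ z ^ 2 := by
        rw [h1] at hder
        linarith [hder]
      have h4 : deriv ψ x ^ 2 * ((1 - η) ^ 2 * x ^ 2)
          ≤ 1024 * M ^ 2 * ψ z ^ 2 * E * x ^ 2 := by
        nlinarith [mul_le_mul_of_nonneg_left hunc (by positivity : 0 ≤ 16 * ψ z ^ 2)]
      have h5 : deriv ψ x ^ 2 * (1 - η) ^ 2 ≤ 1024 * M ^ 2 * ψ z ^ 2 * E :=
        le_of_mul_le_mul_right (by linarith) (by positivity : 0 < x ^ 2)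
      have h6 : 1024 * M ^ 2 / (1 - η) ^ 2 * ψ z ^ 2 * E
          = 1024 * M ^ 2 * ψ z ^ 2 * E / (1 - η) ^ 2 := by ring
      rw [h6, le_div_iff₀ (by positivity)]
      exact h5
    calc ψ x ^ 2 + deriv ψ x ^ 2 / E ≤ (1 + 1024 * M ^ 2 / (1 - η) ^ 2) * ψ z ^ 2 := by linarith
      _ ≤ (1 + 1024 * M ^ 2 / (1 - η) ^ 2) *
          (1 / (η * (1 - η)) / x * Real.exp (-((1 - η) / 4) * x * √(V x))) := by gcongr
      _ = _ := by ring
  intro V ψ E h S x hVx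
  have hE := S.energy_pos h.nonneg
  rcases lt_trichotomy x 0 with hx | rfl | hx
  · simpa [abs_of_neg hx, IsUnitSolution.deriv_comp_neg'] using
      key h.reflect S.reflect (-x) (by linarith) (by simpa using hVx)
  · rw [h.zero] at hVx
    linarith
  · rw [abs_of_pos hx]
    exact key h S x hx hVx

lemma exists_pointwise_bound {κ : ℝ} (hκ : 1 ≤ κ) : ∃ K c : ℝ, 0 < K ∧ 0 < c ∧
    ∀ {V ψ : ℝ → ℝ} {E : ℝ}, IsRegularPotential κ V → IsUnitSolution V E ψ →
      ∀ x, 4 * E ≤ V x → ψ x ^ 2 + deriv ψ x ^ 2 / E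
        ≤ K * (1 / sublevelMeasure V E) * Real.exp (-c * |x| * √(V x)) := by
  obtain ⟨K, c, hK, hc, H⟩ := exists_sq_add_le_tail hκ
  have hM := IsRegularPotential.one_le_scale hκ
  refine ⟨2 * ((4 * κ) ^ κ) ^ 2 * K, c, by positivity, hc, fun {V ψ E} h S x hVx => ?_⟩
  refine (H h S x hVx).trans (mul_le_mul_of_nonneg_right ?_ (Real.exp_pos _).le)
  have hE := S.energy_pos h.nonneg
  obtain ⟨ρ, hρ, rfl⟩ := h.exists_eq hκ hE
  have h1 : ρ ≤ (4 * κ) ^ κ * |x| := by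
    by_contra! hlt
    linarith [h.four_mul_le' hκ hρ hlt.le]
  have h2 := h.sublevelMeasure_le hκ hρ
  have h3 := h.le_sublevelMeasure hκ hρ
  set M := (4 * κ) ^ κ
  have hx : 0 < |x| := pos_of_mul_pos_right (hρ.trans_le h1) (by linarith)
  rw [mul_one_div, div_le_div_iff₀ hx (hρ.trans_le h3)]
  have h4 : sublevelMeasure V (V ρ) ≤ 2 * M * (M * |x|) := h2.trans (by gcongr)
  nlinarith [mul_le_mul_of_nonneg_left h4 hK.le]

/-! ### Weighted integral bounds. -/

lemma IsRegularPotential.rpow_mul_rpow_le {κ : ℝ} {V : ℝ → ℝ} (h : IsRegularPotential κ V)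
    (hκ : 1 ≤ κ) (a b : ℝ) {A ρ x : ℝ} (hA : 1 ≤ A) (hρ : 0 < ρ) (h₁ : |x| ≤ A * ρ)
    (h₂ : ρ ≤ A * |x|) :
    |x| ^ a * V x ^ b ≤ A ^ |a| * (κ * A ^ κ) ^ |b| * (ρ ^ a * V ρ ^ b) := by
  have hx : 0 < |x| := pos_of_mul_pos_right (hρ.trans_le h₂) (by linarith)
  have hκ0 : 0 < κ := by linarith
  have hAκ : 1 ≤ A ^ κ := Real.one_le_rpow hA hκ0.le
  have hVx := h.pos (abs_pos.1 hx)
  have hVρ := h.pos hρ.ne'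
  have hle : ∀ {t y : ℝ}, t ≠ 0 → y ≠ 0 → |t| ≤ A * |y| → V t ≤ κ * A ^ κ * V y := by
    intro t y ht hy hty
    have hVy := h.pos hy
    rcases le_total |t| |y| with hty' | hty'
    · refine (h.le_of_abs_le' hκ ht hty').trans ?_
      gcongr
      refine (Real.rpow_le_one (by positivity) ?_ (by positivity)).trans hAκ
      exact div_le_one_of_le₀ hty' (by positivity)
    · refine (h.le_of_abs_le hκ hy hty').trans ?_
      gcongr
      rw [div_le_iff₀ (abs_pos.2 hy)]
      exact hty
  have h3 := Real.rpow_le_of_ratio hA hx hρ h₁ h₂ a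
  have h4 := Real.rpow_le_of_ratio (by nlinarith : 1 ≤ κ * A ^ κ) hVx hVρ
    (hle (abs_pos.1 hx) hρ.ne' (by rwa [abs_of_pos hρ]))
    (hle hρ.ne' (abs_pos.1 hx) (by rwa [abs_of_pos hρ])) b
  calc |x| ^ a * V x ^ b ≤ (A ^ |a| * ρ ^ a) * ((κ * A ^ κ) ^ |b| * V ρ ^ b) := by gcongr
    _ = _ := by ring

/-- The Cauchy density is a convenient majorant: its integral is explicit and scales linearly in
`ρ`. -/
lemma exists_rpow_mul_exp_le (N : ℝ) {c : ℝ} (hc : 0 < c) : ∃ K : ℝ, 0 < K ∧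
    ∀ s : ℝ, 1 ≤ s → s ^ N * Real.exp (-c * s) ≤ K * (1 + s ^ 2)⁻¹ := by
  obtain ⟨n, hn⟩ := exists_nat_ge N
  refine ⟨2 * ((n + 2).factorial / c ^ (n + 2)), by positivity, fun s hs => ?_⟩
  have hs0 : 0 < s := by linarith
  have h1 : s ^ N ≤ s ^ n := by
    rw [← Real.rpow_natCast]
    exact Real.rpow_le_rpow_of_exponent_le hs hn
  have h2 := Real.pow_div_factorial_le_exp (c * s) (by positivity) (n + 2)
  rw [div_le_iff₀ (by positivity), mul_pow] at h2
  rw [← div_eq_mul_inv, le_div_iff₀ (by positivity), neg_mul, Real.exp_neg, ← mul_div_assoc,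
    mul_assoc, inv_mul_eq_div, ← mul_div_assoc, div_le_div_iff₀ (Real.exp_pos _) (by positivity)]
  calc s ^ N * (1 + s ^ 2) * c ^ (n + 2) ≤ s ^ n * (2 * s ^ 2) * c ^ (n + 2) := by
        gcongr
        nlinarith
    _ = 2 * (c ^ (n + 2) * s ^ (n + 2)) := by ring
    _ ≤ 2 * (Real.exp (c * s) * (n + 2).factorial) := by gcongr
    _ = _ := by ring

lemma lintegral_inv_one_add_div_sq {ρ : ℝ} (hρ : 0 < ρ) :
    ∫⁻ x : ℝ, ENNReal.ofReal ((1 + (x / ρ) ^ 2)⁻¹) = ENNReal.ofReal (ρ * Real.pi) := by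
  have hi : Integrable (fun x : ℝ => (1 + (x / ρ) ^ 2)⁻¹) :=
    integrable_inv_one_add_sq.comp_div hρ.ne'
  rw [← ofReal_integral_eq_lintegral_ofReal hi (Eventually.of_forall fun x => by positivity),
    Measure.integral_comp_div (fun x : ℝ => (1 + x ^ 2)⁻¹) ρ, integral_univ_inv_one_add_sq,
    abs_of_pos hρ, smul_eq_mul]

lemma IsUnitSolution.lintegral_sq_add_le {κ E : ℝ} {V ψ : ℝ → ℝ} (S : IsUnitSolution V E ψ)
    (h : IsRegularPotential κ V) (hκ : 1 ≤ κ) :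
    ∫⁻ x, ENNReal.ofReal (ψ x ^ 2 + deriv ψ x ^ 2 / E) ≤ ENNReal.ofReal 2 := by
  have hE := S.energy_pos h.nonneg
  have hi : Integrable (fun x => ψ x ^ 2 + deriv ψ x ^ 2 / E) :=
    S.integrable_sq.add ((S.integrable_deriv_sq h hκ).div_const E)
  rw [← ofReal_integral_eq_lintegral_ofReal hi
    (Eventually.of_forall fun x => by positivity),
    integral_add S.integrable_sq ((S.integrable_deriv_sq h hκ).div_const E), integral_div,
    S.norm_eq_one]
  refine ENNReal.ofReal_le_ofReal ?_
  have : (∫ x, deriv ψ x ^ 2) / E ≤ 1 := by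
    rw [div_le_one hE]
    exact S.integral_deriv_sq_le h hκ
  linarith

/-- The lower Lebesgue integral makes finiteness part of the conclusion. The integral condition on
`W` is what handles a possible singularity at the origin. -/
lemma exists_weighted_bound {κ : ℝ} (hκ : 1 ≤ κ) (a b : ℝ) : ∃ K : ℝ, 0 < K ∧
    ∀ {V : ℝ → ℝ}, IsRegularPotential κ V → ∀ {W : ℝ → ℝ} {C : ℝ}, AEMeasurable W →
      (∀ x, 0 ≤ W x) → 0 < C → IsDominatedWeight V a b C W →
      ∀ {ψ : ℝ → ℝ} {E : ℝ}, IsUnitSolution V E ψ →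
        ∫⁻ x, ENNReal.ofReal (W x * (ψ x ^ 2 + deriv ψ x ^ 2 / E))
          ≤ ENNReal.ofReal (K * C * sublevelMeasure V E ^ a * E ^ b) := by
  obtain ⟨K₁, c, hK₁, hc, Htail⟩ := exists_sq_add_le_tail hκ
  have hκ0 : 0 < κ := by linarith
  have hM := IsRegularPotential.one_le_scale hκ
  set M := (4 * κ) ^ κ with hMdef
  have hM0 : 0 < M := by linarith
  -- At `|x| = sρ` with `s ≥ 1` the weight grows at most like `s ^ (|a| + κ|b|)`. The rate `c/(8M)`
  -- comes from `√V ≥ √E ≥ 1/(8Mρ)`.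
  obtain ⟨K₂, hK₂, Hexp⟩ := exists_rpow_mul_exp_le (|a| + κ * |b|)
    (by positivity : 0 < c / (8 * M))
  set D := M ^ |a| * (κ * M ^ κ) ^ |b| with hD
  have hD0 : 0 < D := by positivity
  refine ⟨(6 * D + κ ^ |b| * K₁ * K₂ * Real.pi) * (2 * M) ^ |a|,
    mul_pos (add_pos (by positivity) (by have := Real.pi_pos; positivity)) (by positivity), ?_⟩
  intro V h W C hWm hW0 hC hdom ψ E S
  have hE := S.energy_pos h.nonneg
  have hψ := S.continuous
  have hψ' := S.continuous_deriv
  obtain ⟨ρ, hρ, hρE⟩ := h.exists_eq hκ hE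
  set Q := C * (ρ ^ a * E ^ b) with hQ
  have hQ0 : 0 < Q := by positivity
  set g := fun x => ψ x ^ 2 + deriv ψ x ^ 2 / E with hg
  have hg0 : ∀ x, 0 ≤ g x := fun x => by positivity
  have hgc : Continuous g := by fun_prop
  set I := Set.Icc (-(ρ / M)) (ρ / M) with hI
  have hWle : ∀ (A x : ℝ), 1 ≤ A → |x| ≤ A * ρ → ρ ≤ A * |x| →
      C * (|x| ^ a * V x ^ b) ≤ A ^ |a| * (κ * A ^ κ) ^ |b| * Q := by
    intro A x hA h1 h2
    have := h.rpow_mul_rpow_le hκ a b hA hρ h1 h2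
    rw [hρE] at this
    calc _ ≤ C * (A ^ |a| * (κ * A ^ κ) ^ |b| * (ρ ^ a * E ^ b)) := by gcongr
      _ = _ := by rw [hQ]; ring
  have hbulk : ∀ x ∈ I, g x ≤ 4 * M / ρ := by
    intro x hx
    refine S.sq_add_le_bulk h hκ hρ hρE ?_
    rw [← hMdef, mul_comm, ← le_div_iff₀ hM0]
    exact abs_le.2 hx
  have htail : ∀ x, M * ρ ≤ |x| →
      W x * g x ≤ κ ^ |b| * K₁ * K₂ * Q / ρ * (1 + (x / ρ) ^ 2)⁻¹ := by
    intro x hx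
    have hx0 : 0 < |x| := lt_of_lt_of_le (by positivity) hx
    set s := |x| / ρ with hs
    have hsM : M ≤ s := (le_div_iff₀ hρ).2 hx
    have hs1 : 1 ≤ s := hM.trans hsM
    have hs0 : 0 < s := by linarith
    have hxs : |x| = s * ρ := by rw [hs]; field_simp
    have hVx : 4 * E ≤ V x := by
      rw [← hρE]
      exact h.four_mul_le hκ hρ hx
    have h1 : W x ≤ κ ^ |b| * s ^ (|a| + κ * |b|) * Q := by
      have h2 := hdom.pointwise x (abs_pos.1 hx0)
      rw [mul_assoc] at h2
      refine (h2.trans (hWle s x hs1 hxs.le (by rw [hxs]; nlinarith))).trans_eq ?_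
      rw [Real.mul_rpow hκ0.le (by positivity), ← Real.rpow_mul hs0.le, Real.rpow_add hs0]
      ring
    have h3 : g x ≤ K₁ / ρ * Real.exp (-(c / (8 * M)) * s) := by
      refine (Htail h S x hVx).trans ?_
      have h4 : ρ ≤ |x| := by rw [hxs]; nlinarith
      have h5 : -c * |x| * √(V x) ≤ -(c / (8 * M)) * s := by
        have h6 := S.one_le_mul_sqrt h hκ hρ hρE
        rw [← hMdef] at h6
        have h7 : √E ≤ √(V x) := Real.sqrt_le_sqrt (by linarith)
        have h8 : 1 ≤ 8 * M * (ρ * √(V x)) := h6.trans (by gcongr)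
        have h9 : c / (8 * M) * s * 1 ≤ c / (8 * M) * s * (8 * M * (ρ * √(V x))) := by gcongr
        have h10 : c / (8 * M) * s * (8 * M * (ρ * √(V x))) = c * (s * ρ) * √(V x) := by
          field_simp
        rw [hxs]
        linarith
      gcongr
    have h4 : (x / ρ) ^ 2 = s ^ 2 := by rw [hs, div_pow, div_pow, sq_abs]
    rw [h4]
    calc W x * g x ≤ (κ ^ |b| * s ^ (|a| + κ * |b|) * Q) *
          (K₁ / ρ * Real.exp (-(c / (8 * M)) * s)) :=
          mul_le_mul h1 h3 (hg0 x) (by positivity)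
      _ = κ ^ |b| * K₁ * Q / ρ * (s ^ (|a| + κ * |b|) * Real.exp (-(c / (8 * M)) * s)) := by ring
      _ ≤ κ ^ |b| * K₁ * Q / ρ * (K₂ * (1 + s ^ 2)⁻¹) :=
          mul_le_mul_of_nonneg_left (Hexp s hs1) (by positivity)
      _ = _ := by ring
  have hinner : ∫⁻ x in I, ENNReal.ofReal (W x) ≤ ENNReal.ofReal (ρ / M * (D * Q)) := by
    have hr : 0 < ρ / M := by positivity
    have h1 := hdom.integral (ρ / M) hr.ne'
    rw [abs_of_pos hr] at h1
    refine h1.trans (ENNReal.ofReal_le_ofReal ?_)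
    have h2 := hWle M (ρ / M) hM (by rw [abs_of_pos hr, div_le_iff₀ hM0]; nlinarith [mul_pos hM0 hρ])
      (by rw [abs_of_pos hr]; field_simp; rfl)
    rw [abs_of_pos hr] at h2
    rw [Real.rpow_add_one hr.ne']
    calc _ = ρ / M * (C * ((ρ / M) ^ a * V (ρ / M) ^ b)) := by ring
      _ ≤ _ := by gcongr
  -- The three summands dominate the integrand on the bulk, the transition zone and the tail
  -- respectively; their integrals contribute `4D`, `2D` and the term with `π`.
  have hpt : ∀ x, ENNReal.ofReal (W x * g x) ≤
      ENNReal.ofReal (4 * M / ρ) * I.indicator (fun x => ENNReal.ofReal (W x)) x +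
      ENNReal.ofReal (D * Q) * ENNReal.ofReal (g x) +
      ENNReal.ofReal (κ ^ |b| * K₁ * K₂ * Q / ρ) * ENNReal.ofReal ((1 + (x / ρ) ^ 2)⁻¹) := by
    intro x
    by_cases hxI : x ∈ I
    · refine le_trans ?_ (le_self_add.trans le_self_add)
      rw [Set.indicator_of_mem hxI, ← ENNReal.ofReal_mul (by positivity), mul_comm]
      exact ENNReal.ofReal_le_ofReal (mul_le_mul_of_nonneg_right (hbulk x hxI) (hW0 x))
    · have hx : ρ / M ≤ |x| := by
        by_contra! hlt
        exact hxI (abs_le.1 hlt.le)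
      rcases le_total (M * ρ) |x| with hxM | hxM
      · refine le_trans ?_ le_add_self
        rw [← ENNReal.ofReal_mul (by positivity)]
        exact ENNReal.ofReal_le_ofReal (htail x hxM)
      · refine le_trans ?_ (le_add_self.trans le_self_add)
        rw [← ENNReal.ofReal_mul (by positivity)]
        refine ENNReal.ofReal_le_ofReal (mul_le_mul_of_nonneg_right ?_ (hg0 x))
        have hx0 : x ≠ 0 := abs_pos.1 (lt_of_lt_of_le (by positivity) hx)
        have h2 := hdom.pointwise x hx0
        rw [mul_assoc] at h2
        refine h2.trans (hWle M x hM hxM ?_)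
        rw [div_le_iff₀ hM0] at hx
        linarith
  calc ∫⁻ x, ENNReal.ofReal (W x * g x)
      ≤ _ := lintegral_mono hpt
    _ = ENNReal.ofReal (4 * M / ρ) * (∫⁻ x in I, ENNReal.ofReal (W x)) +
        ENNReal.ofReal (D * Q) * (∫⁻ x, ENNReal.ofReal (g x)) +
        ENNReal.ofReal (κ ^ |b| * K₁ * K₂ * Q / ρ) *
          ∫⁻ x : ℝ, ENNReal.ofReal ((1 + (x / ρ) ^ 2)⁻¹) := by
        rw [lintegral_add_right _ (by fun_prop), lintegral_add_right _ (by fun_prop),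
          lintegral_const_mul' _ _ ENNReal.ofReal_ne_top,
          lintegral_const_mul' _ _ ENNReal.ofReal_ne_top,
          lintegral_const_mul' _ _ ENNReal.ofReal_ne_top, lintegral_indicator measurableSet_Icc]
    _ ≤ ENNReal.ofReal (4 * M / ρ) * ENNReal.ofReal (ρ / M * (D * Q)) +
        ENNReal.ofReal (D * Q) * ENNReal.ofReal 2 +
        ENNReal.ofReal (κ ^ |b| * K₁ * K₂ * Q / ρ) * ENNReal.ofReal (ρ * Real.pi) := by
        rw [lintegral_inv_one_add_div_sq hρ]
        gcongr
        exact S.lintegral_sq_add_le h hκ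
    _ = ENNReal.ofReal ((6 * D + κ ^ |b| * K₁ * K₂ * Real.pi) * Q) := by
        have hπ := Real.pi_pos
        rw [← ENNReal.ofReal_mul (by positivity), ← ENNReal.ofReal_mul (by positivity),
          ← ENNReal.ofReal_mul (by positivity), ← ENNReal.ofReal_add (by positivity)
          (by positivity), ← ENNReal.ofReal_add (by positivity) (by positivity)]
        congr 1
        field_simp
        ring
    _ ≤ _ := by
        refine ENNReal.ofReal_le_ofReal ?_
        have h1 := h.le_sublevelMeasure hκ hρ
        have h2 := h.sublevelMeasure_le hκ hρ
        rw [hρE] at h1 h2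
        have hπ := Real.pi_pos
        -- Trading `ρ ^ a` for `|{V ≤ E}| ^ a` costs `(2M) ^ |a|`, whatever the sign of `a`.
        have h3 := Real.rpow_le_of_ratio (by linarith : 1 ≤ 2 * M) hρ (hρ.trans_le h1)
          (by nlinarith) h2 a
        have hB : 0 ≤ (6 * D + κ ^ |b| * K₁ * K₂ * Real.pi) * C * E ^ b := by positivity
        calc _ = (6 * D + κ ^ |b| * K₁ * K₂ * Real.pi) * C * E ^ b * ρ ^ a := by rw [hQ]; ring
          _ ≤ (6 * D + κ ^ |b| * K₁ * K₂ * Real.pi) * C * E ^ b *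
              ((2 * M) ^ |a| * sublevelMeasure V E ^ a) := mul_le_mul_of_nonneg_left h3 hB
          _ = _ := by ring

/-! ### The main theorem. -/

theorem theorem6p4 (κ : ℝ) (hκ : 1 ≤ κ) :
    -- pointwise bounds
    (∃ K c : ℝ, 0 < K ∧ 0 < c ∧
      ∀ V : ℝ → ℝ, IsRegularPotential κ V →
      ∀ (n : ℕ) (E : ℝ) (ψ : ℝ → ℝ),
        IsNthEigenvalue V n E → IsNormalizedEigenfunction V E ψ →
      ∀ x : ℝ, 4 * E ≤ V x →
        ψ x ^ 2 + deriv ψ x ^ 2 / E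
          ≤ K * (1 / sublevelMeasure V E) * Real.exp (-c * |x| * √(V x))) ∧
    -- weighted integral bounds
    (∀ a b : ℝ, ∃ K : ℝ, 0 < K ∧
      ∀ V : ℝ → ℝ, IsRegularPotential κ V →
      ∀ (W : ℝ → ℝ) (C : ℝ), AEMeasurable W → (∀ x, 0 ≤ W x) → 0 < C →
        IsDominatedWeight V a b C W →
      ∀ (n : ℕ) (E : ℝ) (ψ : ℝ → ℝ),
        IsNthEigenvalue V n E → IsNormalizedEigenfunction V E ψ →
        ∫⁻ x, ENNReal.ofReal (W x * (ψ x ^ 2 + deriv ψ x ^ 2 / E))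
          ≤ ENNReal.ofReal (K * C * sublevelMeasure V E ^ a * E ^ b)) ∧
    -- power weights
    (∀ a b : ℝ, -1 < a + min (κ⁻¹ * b) (κ * b) → ∃ C : ℝ, 0 < C ∧
      ∀ V : ℝ → ℝ, IsRegularPotential κ V →
        IsDominatedWeight V a b C (fun x => |x| ^ a * V x ^ b)) := by
  refine ⟨?_, fun a b => ?_, fun a b hab => IsRegularPotential.exists_isDominatedWeight hκ hab⟩
  · obtain ⟨K, c, hK, hc, H⟩ := exists_pointwise_bound hκ
    exact ⟨K, c, hK, hc, fun V hV _ E ψ _ hψ => H hV hψ.isUnitSolution⟩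
  · obtain ⟨K, hK, H⟩ := exists_weighted_bound hκ a b
    exact ⟨K, hK, fun V hV W C hWm hW hC hdom _ E ψ _ hψ =>
      H hV hWm hW hC hdom hψ.isUnitSolution⟩
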